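/- **Setting.** Fix constants $0<\rho\le \bar v$. A buyer takes part in $T\ge 1$ repeated second-price auctions with total budget $B=\rho T$. In round $t=1,\dots,T$ she sees her value $v_t$, chooses $x_t\in\{0,1\}$ (enter or not, bidding truthfully if she enters), and, with $p_t$ the highest competing bid, gets revenue $x_t r_t$ at cost $x_t c_t$, where $r_t=(v_t-p_t)^+$ and $c_t=p_t\mathbf 1[v_t\ge p_t]$. The values $v_1,\dots,v_T$ are i.i.d. from a distribution $F$ on $[0,\bar v]$, the bids $p_1,\dots,p_T$ are i.i.d. from a distribution $G$ on $[0,\bar v]$, and all of these are mutually independent. Feedback is full information: $p_t$ is revealed at the end of round $t$ whatever $x_t$ is. **Algorithm OGD-CB** (full information). Initialize $\mathcal I_1=\emptyset$, $B_1=B=\rho T$, $\lambda_1=0$. In round $1$ put $x_1=1$ and $\lambda_2=\lambda_1$. In round $t\ge2$, after seeing $v_t$, put $$\epsilon_t=\sqrt{\frac{\ln 2+2\ln T}{2|\mathcal I_t|}},\qquad \tilde r_t=\frac1{|\mathcal I_t|}\sum_{\tau\in\mathcal I_t}(v_t-p_\tau)^+ +\epsilon_t v_t,\qquad \tilde c_t=\frac1{|\mathcal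 I_t|}\sum_{\tau\in\mathcal I_t}p_\tau\mathbf 1[v_t\ge p_\tau]-2\epsilon_t v_t,$$ $$x_t=\mathbf 1[\tilde r_t\ge\lambda_t\tilde c_t],\qquad \lambda_{t+1}=\bigl(\lambda_t+\eta_t(x_t\tilde c_t-\rho)\bigr)^+,\qquad \eta_t=\frac1{\bar v\sqrt t}.$$ At the end of every round $t\ge 1$, put $\mathcal I_{t+1}=\mathcal I_t\cup\{t\}$ and $B_{t+1}=B_t-x_tc_t$, and stop (all later decisions are $0$) if $B_{t+1}<\bar v$. **Benchmark and regret.** Let $$\mathrm{OPT}=T\cdot\sup_{\pi}\ \mathbb E_{v\sim F,\,p\sim G}\bigl[\pi(v)(v-p)^+\bigr],$$ over measurable $\pi:[0,\bar v]\to[0,1]$ with $\mathbb E_{v\sim F,\,p\sim G}\bigl[\pi(v)\,p\,\mathbf 1[v\ge p]\bigr]\le\rho$, and let $\mathrm{Reg}=\mathrm{OPT}-\sum_{t=1}^{T}x_t(v_t-p_t)^+$ be the regret of OGD-CB. **Theorem.** There is a constant $C>0$, depending only on $\bar v$ and $\rho$, such that for all distributions $F,G$ on $[0,\bar v]$ and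 all $T\ge1$, $$\Pr\Bigl[\mathrm{Reg}\le C\sqrt{T\ln T}\Bigr]\ \ge\ 1-\frac4T ,$$ and moreover $\mathrm{Reg}$ is integrable with $\mathbb E[\mathrm{Reg}]\le C\sqrt{T\ln T}$. -/

import Mathlib

namespace Throttling

/-- Revenue `(v - p)⁺` of entering a second-price auction with value `v` (bid truthfully)
against highest competing bid `p`. -/
noncomputable def reward (v p : ℝ) : ℝ := max (v - p) 0

/-- Payment `p · 1[v ≥ p]` of entering a second-price auction with value `v`
against highest competing bid `p`. -/
noncomputable def cost (v p : ℝ) : ℝ := if p ≤ v then p else 0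

/-- A (measurable) static randomized throttling rule `π : [0, vmax] → [0, 1]`
whose expected cost per round is at most `ρ`. -/
structure Feasible (vmax ρ : ℝ) (F G : MeasureTheory.Measure ℝ) (π : ℝ → ℝ) : Prop where
  measurable : Measurable π
  mem_unit : ∀ v ∈ Set.Icc 0 vmax, π v ∈ Set.Icc (0 : ℝ) 1
  cost_le : ∫ z, π z.1 * cost z.1 z.2 ∂(F.prod G) ≤ ρ

/-- The fluid benchmark `OPT`: `T` times the optimal expected one-round revenue over
feasible static rules. -/
noncomputable def OPT (vmax ρ : ℝ) (T : ℕ) (F G : MeasureTheory.Measure ℝ) : ℝ :=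
  T * sSup {R : ℝ | ∃ π : ℝ → ℝ, Feasible vmax ρ F G π ∧
    R = ∫ z, π z.1 * reward z.1 z.2 ∂(F.prod G)}

/-- Confidence radius `ε = √((ln 2 + 2 ln T) / (2 n))` for `n` observed samples. -/
noncomputable def radius (T n : ℕ) : ℝ :=
  Real.sqrt ((Real.log 2 + 2 * Real.log T) / (2 * n))

/-- Optimistic revenue estimate at value `w` from the bids `p τ`, `τ ∈ I`. -/
noncomputable def rewardEst (T : ℕ) (p : ℕ → ℝ) (I : Finset ℕ) (w : ℝ) : ℝ :=
  (∑ τ ∈ I, reward w (p τ)) / I.card + radius T I.card * w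

/-- Optimistic cost estimate at value `w` from the bids `p τ`, `τ ∈ I`. -/
noncomputable def costEst (T : ℕ) (p : ℕ → ℝ) (I : Finset ℕ) (w : ℝ) : ℝ :=
  (∑ τ ∈ I, cost w (p τ)) / I.card - 2 * radius T I.card * w

/-- Internal state of OGD-CB at the start of a round. -/
structure State where
  /-- the rounds whose highest competing bid has been observed, `I_t` -/
  samples : Finset ℕ
  /-- the remaining budget `B_t` -/
  budget : ℝ
  /-- the pricing variable `λ_t` -/
  price : ℝ
  /-- whether the main loop has been left -/
  halted : Prop

/-- Initial state, with total budget `B = ρ T`. -/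
noncomputable def initState (ρ : ℝ) (T : ℕ) : State where
  samples := ∅
  budget := ρ * T
  price := 0
  halted := False

open Classical in
/-- The action `x_t ∈ {0, 1}` in round `t` from state `s` (it uses only `p τ` with
`τ ∈ s.samples`). No auction is entered after the loop has been left. -/
noncomputable def action (T : ℕ) (v p : ℕ → ℝ) (t : ℕ) (s : State) : ℝ :=
  if s.halted then 0
  else if t = 1 then 1
  else if s.price * costEst T p s.samples (v t) ≤ rewardEst T p s.samples (v t) then 1
  else 0

open Classical in
/-- Round `t` of OGD-CB with full information feedback: the bid `p t` is observed whatever the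
action is, the price makes an online gradient step of size `1 / (vmax √t)` (except in the
exploration round `t = 1`), and the loop is left once the remaining budget is below `vmax`. -/
noncomputable def step (vmax ρ : ℝ) (T : ℕ) (v p : ℕ → ℝ) (t : ℕ) (s : State) : State :=
  if s.halted then s
  else
    { samples := insert t s.samples
      budget := s.budget - action T v p t s * cost (v t) (p t)
      price :=
        if t = 1 then s.price
        else max (s.price + 1 / (vmax * Real.sqrt t) *
          (action T v p t s * costEst T p s.samples (v t) - ρ)) 0
      halted := s.budget - action T v p t s * cost (v t) (p t) < vmax }

/-- State of OGD-CB after `n` rounds (so at the start of round `n + 1`). Rounds are numbered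
`1, 2, …, T`. -/
noncomputable def stateAfter (vmax ρ : ℝ) (T : ℕ) (v p : ℕ → ℝ) : ℕ → State
  | 0 => initState ρ T
  | n + 1 => step vmax ρ T v p (n + 1) (stateAfter vmax ρ T v p n)

/-- Decision `x_t` of OGD-CB in round `t ≥ 1`. -/
noncomputable def decision (vmax ρ : ℝ) (T : ℕ) (v p : ℕ → ℝ) (t : ℕ) : ℝ :=
  action T v p t (stateAfter vmax ρ T v p (t - 1))

/-- Total revenue of OGD-CB over the rounds `1, …, T`. (Decisions are `0` after the last round
that is entered, so this is also the sum up to that round.) -/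
noncomputable def revenue (vmax ρ : ℝ) (T : ℕ) (v p : ℕ → ℝ) : ℝ :=
  ∑ t ∈ Finset.Icc 1 T, decision vmax ρ T v p t * reward (v t) (p t)

/-- Regret of OGD-CB against the fluid benchmark, on values `v` and competing bids `p`. -/
noncomputable def regret (vmax ρ : ℝ) (T : ℕ) (F G : MeasureTheory.Measure ℝ)
    (v p : ℕ → ℝ) : ℝ :=
  OPT vmax ρ T F G - revenue vmax ρ T v p

end Throttling

/-! The algorithm is a primal-dual method for a budgeted problem. Fix a feasible rule `π` whose mean
revenue is within `1/T` of the supremum, and write `R w`, `C w` for the mean revenue and cost at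
value `w`. While the loop runs, the decision maximizes `x * (r̃ - λ * c̃)` over `x` in `[0, 1]`, so
it does at least as well as `π w`. On the event that the estimates are accurate, `r̃` overestimates
`R` and `c̃` underestimates `C`, so this exceeds `π w * (R w - λ * C w)` up to a multiple of the
confidence radius (`InBox.lagrange_step`). The radii sum to order `√(T log T)`.

The price runs online gradient descent, which can be compared with any fixed `u ≥ 0` at a cost of
order `√T + log T` (`InBox.sum_gradient_le`). This needs bounded prices (`InBox.price_le`). If the
loop is never left early, `u = 0` gives the regret bound. If it is, almost all of the budget has
been spent, and `u = vmax / ρ` makes the credit for this spending cover the revenue lost afterwards,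
since a round is worth at most `vmax` (`InBox.regret_le`).

What remains is concentration. Decisions and prices depend only on the past and the current value,
so realized revenue, realized cost and the Lagrangian comparison with `π` are controlled by
Azuma–Hoeffding (`IIDPath.measure_sum_gt_le`). The estimates use earlier bids, independent of the
next value, so that value can be frozen (`IIDPath.measure_le_of_ae`). The expectation bound follows
from the high-probability one because the regret never exceeds `T * vmax`. -/

namespace Throttling
open MeasureTheory ProbabilityTheory

/-! ### Independent innovations and Azuma–Hoeffding -/

/-- The path that keeps the entries of `h` with index at most `n` and is `0` afterwards. -/
def trunc {E : Type*} [Zero E] (n : ℕ) (h : ℕ → E) : ℕ → E := fun s => if s ≤ n then h s else 0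

theorem trunc_apply_of_le {E : Type*} [Zero E] {n s : ℕ} (hs : s ≤ n) (h : ℕ → E) :
    trunc n h s = h s := if_pos hs

theorem trunc_trunc {E : Type*} [Zero E] {m n : ℕ} (hmn : m ≤ n) (h : ℕ → E) :
    trunc m (trunc n h) = trunc m h := by
  funext s
  unfold trunc
  split_ifs with h1 h2
  · rfl
  · omega
  · rfl

theorem measurable_trunc {E : Type*} [Zero E] [MeasurableSpace E] (n : ℕ) :
    Measurable (trunc n : (ℕ → E) → ℕ → E) := by
  refine measurable_pi_lambda _ fun s => ?_
  unfold trunc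
  by_cases hs : s ≤ n
  · simpa [hs] using measurable_pi_apply s
  · simp [hs]

/-- `Z 1, …, Z T` are distributed as `ν` and each is independent of the ones before it. -/
structure IIDPath {Ω E : Type*} [MeasurableSpace Ω] [MeasurableSpace E] [Zero E]
    (μ : Measure Ω) (ν : Measure E) (T : ℕ) (Z : Ω → ℕ → E) : Prop where
  measurable : Measurable Z
  law : ∀ i < T, μ.map (fun ω => Z ω (i + 1)) = ν
  indep : ∀ i < T, IndepFun (fun ω => trunc i (Z ω)) (fun ω => Z ω (i + 1)) μ

theorem lintegral_comp_of_indepFun {Ω α β : Type*} [MeasurableSpace Ω] [MeasurableSpace α]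
    [MeasurableSpace β] {μ : Measure Ω} [IsFiniteMeasure μ] {X : Ω → α} {Y : Ω → β}
    (hX : Measurable X) (hY : Measurable Y) (h : IndepFun X Y μ) {f : α × β → ENNReal}
    (hf : Measurable f) :
    ∫⁻ ω, f (X ω, Y ω) ∂μ = ∫⁻ ω, ∫⁻ y, f (X ω, y) ∂(μ.map Y) ∂μ := by
  have h1 := h.map_prod_eq_prod_map_map hX.aemeasurable hY.aemeasurable
  rw [← lintegral_map (f := f) (g := fun ω => (X ω, Y ω)) hf (hX.prodMk hY), h1,
    lintegral_prod _ hf.aemeasurable,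
    lintegral_map (f := fun x => ∫⁻ y, f (x, y) ∂(μ.map Y)) hf.lintegral_prod_right' hX]

/-- Hoeffding's lemma. Since `s ≥ 0`, centring a variable of nonpositive mean only increases the
exponential, so a one-sided mean condition suffices. -/
theorem lintegral_exp_le_of_mem_Icc {E : Type*} [MeasurableSpace E] {ν : Measure E}
    [IsProbabilityMeasure ν] {f : E → ℝ} (hf : Measurable f) {a c s : ℝ} (hs : 0 ≤ s)
    (hb : ∀ᵐ z ∂ν, f z ∈ Set.Icc a (a + 2 * c)) (hm : ∫ z, f z ∂ν ≤ 0) :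
    ∫⁻ z, ENNReal.ofReal (Real.exp (s * f z)) ∂ν ≤ ENNReal.ofReal (Real.exp (s ^ 2 * c ^ 2 / 2)) := by
  have hsub := hasSubgaussianMGF_of_mem_Icc hf.aemeasurable hb
  calc ∫⁻ z, ENNReal.ofReal (Real.exp (s * f z)) ∂ν
      ≤ ∫⁻ z, ENNReal.ofReal (Real.exp (s * (f z - ∫ z, f z ∂ν))) ∂ν := by
        refine lintegral_mono fun z => ENNReal.ofReal_le_ofReal (Real.exp_le_exp.2 ?_)
        nlinarith
    _ = ENNReal.ofReal (mgf (fun z => f z - ∫ z, f z ∂ν) ν s) := by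
        rw [mgf, ofReal_integral_eq_lintegral_ofReal (hsub.integrable_exp_mul s)]
        exact Filter.Eventually.of_forall fun z => (Real.exp_pos _).le
    _ ≤ _ := by
        refine ENNReal.ofReal_le_ofReal ((hsub.mgf_le s).trans (Real.exp_le_exp.2 (le_of_eq ?_)))
        simp only [add_sub_cancel_left, NNReal.coe_pow, NNReal.coe_div, coe_nnnorm, Real.norm_eq_abs,
          NNReal.coe_ofNat, div_pow, sq_abs]
        ring

section Azuma
variable {Ω E : Type*} [MeasurableSpace Ω] [MeasurableSpace E] [Zero E]
  {μ : Measure Ω} [IsProbabilityMeasure μ] {ν : Measure E} [IsProbabilityMeasure ν] {T : ℕ}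
  {Z : Ω → ℕ → E}

theorem measurable_increment {D : (ℕ → E) → E → ℝ} (hD : Measurable (Function.uncurry D)) (i : ℕ) :
    Measurable fun h : ℕ → E => D (trunc i h) (h (i + 1)) :=
  hD.comp ((measurable_trunc i).prodMk (measurable_pi_apply (i + 1)))

/-- The increment `D i` sees the past only through `trunc i`, hence is independent of the future
given that past. Integrating out the last entry by Fubini peels off one Hoeffding factor. The
interval may move with the history; only its length `2 * c` is fixed. -/
theorem IIDPath.lintegral_exp_sum_le (hZ : IIDPath μ ν T Z) {D : ℕ → (ℕ → E) → E → ℝ} {c s : ℝ}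
    (hs : 0 ≤ s) {n : ℕ} (hn : n ≤ T)
    (hD : ∀ i < n, Measurable (Function.uncurry (D i)))
    (hb : ∀ i < n, ∀ ω, ∃ a, ∀ᵐ z ∂ν, D i (trunc i (Z ω)) z ∈ Set.Icc a (a + 2 * c))
    (hm : ∀ i < n, ∀ ω, ∫ z, D i (trunc i (Z ω)) z ∂ν ≤ 0) :
    ∫⁻ ω, ENNReal.ofReal (Real.exp
        (s * ∑ i ∈ Finset.range n, D i (trunc i (Z ω)) (Z ω (i + 1)))) ∂μ ≤
      ENNReal.ofReal (Real.exp (n * (s ^ 2 * c ^ 2 / 2))) := by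
  induction n with
  | zero => simp
  | succ n ih =>
    specialize ih (by omega) (fun i hi => hD i (by omega)) (fun i hi => hb i (by omega))
      (fun i hi => hm i (by omega))
    set S : (ℕ → E) → ℝ := fun h => ∑ i ∈ Finset.range n, D i (trunc i h) (h (i + 1)) with hS
    have hSm : Measurable S := Finset.measurable_sum _ fun i hi =>
      measurable_increment (hD i (by simp at hi; omega)) i
    have hStr : ∀ h, S (trunc n h) = S h := fun h => by
      refine Finset.sum_congr rfl fun i hi => ?_
      have hi' : i + 1 ≤ n := by simpa using hi
      rw [trunc_trunc (by omega), trunc_apply_of_le hi']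
    have hX : Measurable fun ω => trunc n (Z ω) := (measurable_trunc n).comp hZ.measurable
    have hY : Measurable fun ω => Z ω (n + 1) := (measurable_pi_apply _).comp hZ.measurable
    let f : (ℕ → E) × E → ENNReal := fun q =>
      ENNReal.ofReal (Real.exp (s * S q.1)) * ENNReal.ofReal (Real.exp (s * D n q.1 q.2))
    have hDn := hD n (by omega)
    have hf : Measurable f := by
      refine Measurable.mul (f := fun q : (ℕ → E) × E => ENNReal.ofReal (Real.exp (s * S q.1)))
        (g := fun q => ENNReal.ofReal (Real.exp (s * D n q.1 q.2))) ?_ ?_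
      · exact (Real.measurable_exp.comp ((hSm.comp measurable_fst).const_mul s)).ennreal_ofReal
      · exact (Real.measurable_exp.comp (hDn.const_mul s)).ennreal_ofReal
    have key := lintegral_comp_of_indepFun hX hY (hZ.indep n (by omega)) hf
    rw [hZ.law n (by omega)] at key
    calc ∫⁻ ω, ENNReal.ofReal (Real.exp
        (s * ∑ i ∈ Finset.range (n + 1), D i (trunc i (Z ω)) (Z ω (i + 1)))) ∂μ
        = ∫⁻ ω, f (trunc n (Z ω), Z ω (n + 1)) ∂μ := by
          refine lintegral_congr fun ω => ?_
          simp only [f]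
          rw [hStr, ← ENNReal.ofReal_mul (Real.exp_pos _).le, ← Real.exp_add,
            Finset.sum_range_succ, mul_add]
      _ = _ := key
      _ ≤ ∫⁻ ω, ENNReal.ofReal (Real.exp (s * S (Z ω))) *
            ENNReal.ofReal (Real.exp (s ^ 2 * c ^ 2 / 2)) ∂μ := by
          refine lintegral_mono fun ω => ?_
          have hDω : Measurable (D n (trunc n (Z ω))) := hDn.comp measurable_prodMk_left
          simp only [f]
          have hexp : Measurable fun y =>
              ENNReal.ofReal (Real.exp (s * D n (trunc n (Z ω)) y)) :=
            (Real.measurable_exp.comp (hDω.const_mul s)).ennreal_ofReal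
          rw [lintegral_const_mul _ hexp, hStr]
          gcongr
          obtain ⟨a, ha⟩ := hb n (by omega) ω
          exact lintegral_exp_le_of_mem_Icc hDω hs ha (hm n (by omega) ω)
      _ = (∫⁻ ω, ENNReal.ofReal (Real.exp (s * S (Z ω))) ∂μ) *
            ENNReal.ofReal (Real.exp (s ^ 2 * c ^ 2 / 2)) :=
          lintegral_mul_const _ (Real.measurable_exp.comp
            ((hSm.comp hZ.measurable).const_mul s)).ennreal_ofReal
      _ ≤ ENNReal.ofReal (Real.exp (n * (s ^ 2 * c ^ 2 / 2))) *
            ENNReal.ofReal (Real.exp (s ^ 2 * c ^ 2 / 2)) := by gcongr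
      _ = _ := by
          rw [← ENNReal.ofReal_mul (Real.exp_pos _).le, ← Real.exp_add]
          congr 2
          push_cast
          ring

/-- Azuma–Hoeffding inequality for a process with independent innovations. -/
theorem IIDPath.measure_sum_gt_le (hZ : IIDPath μ ν T Z) {D : ℕ → (ℕ → E) → E → ℝ} {c L : ℝ}
    (hc : 0 < c) (hL : 0 ≤ L) {n : ℕ} (hn : n ≤ T)
    (hD : ∀ i < n, Measurable (Function.uncurry (D i)))
    (hb : ∀ i < n, ∀ ω, ∃ a, ∀ᵐ z ∂ν, D i (trunc i (Z ω)) z ∈ Set.Icc a (a + 2 * c))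
    (hm : ∀ i < n, ∀ ω, ∫ z, D i (trunc i (Z ω)) z ∂ν ≤ 0) :
    μ {ω | c * Real.sqrt (2 * n * L) <
        ∑ i ∈ Finset.range n, D i (trunc i (Z ω)) (Z ω (i + 1))} ≤
      ENNReal.ofReal (Real.exp (-L)) := by
  rcases Nat.eq_zero_or_pos n with rfl | hn0
  · simp
  have hn0' : (0 : ℝ) < n := by exact_mod_cast hn0
  set a := c * Real.sqrt (2 * n * L) with ha
  have ha2 : a ^ 2 = c ^ 2 * (2 * n * L) := by
    rw [ha, mul_pow, Real.sq_sqrt (by positivity)]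
  have ha0 : 0 ≤ a := by positivity
  -- This `s` minimizes the Chernoff exponent `n * (s ^ 2 * c ^ 2 / 2) - s * a`.
  set s := a / (n * c ^ 2) with hs
  have hs0 : 0 ≤ s := by positivity
  have h1 := hZ.lintegral_exp_sum_le hs0 hn hD hb hm
  have h2 := mul_meas_ge_le_lintegral₀ (μ := μ)
    (f := fun ω => ENNReal.ofReal (Real.exp
      (s * ∑ i ∈ Finset.range n, D i (trunc i (Z ω)) (Z ω (i + 1)))))
    (Real.measurable_exp.comp ((Finset.measurable_sum _ fun i hi =>
      (measurable_increment (hD i (by simpa using hi)) i).comp hZ.measurable).const_mul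
        s)).ennreal_ofReal.aemeasurable (ENNReal.ofReal (Real.exp (s * a)))
  have h3 : ENNReal.ofReal (Real.exp (s * a)) * μ {ω | a <
        ∑ i ∈ Finset.range n, D i (trunc i (Z ω)) (Z ω (i + 1))} ≤
      ENNReal.ofReal (Real.exp (n * (s ^ 2 * c ^ 2 / 2))) := by
    refine le_trans ?_ (h2.trans h1)
    gcongr with ω
    intro h
    exact ENNReal.ofReal_le_ofReal (Real.exp_le_exp.2 (mul_le_mul_of_nonneg_left (le_of_lt h) hs0))
  have h4 : ENNReal.ofReal (Real.exp (-(s * a))) * ENNReal.ofReal (Real.exp (s * a)) = 1 := by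
    rw [← ENNReal.ofReal_mul (Real.exp_pos _).le, ← Real.exp_add]
    simp
  calc μ {ω | a < ∑ i ∈ Finset.range n, D i (trunc i (Z ω)) (Z ω (i + 1))}
      = ENNReal.ofReal (Real.exp (-(s * a))) * (ENNReal.ofReal (Real.exp (s * a)) *
          μ {ω | a < ∑ i ∈ Finset.range n, D i (trunc i (Z ω)) (Z ω (i + 1))}) := by
        rw [← mul_assoc, h4, one_mul]
    _ ≤ ENNReal.ofReal (Real.exp (-(s * a))) *
          ENNReal.ofReal (Real.exp (n * (s ^ 2 * c ^ 2 / 2))) := by gcongr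
    _ = ENNReal.ofReal (Real.exp (-L)) := by
        rw [← ENNReal.ofReal_mul (Real.exp_pos _).le, ← Real.exp_add]
        congr 2
        have h5 : s * a = 2 * L := by
          rw [hs, div_mul_eq_mul_div, ← sq, ha2]
          field_simp
        have h6 : n * (s ^ 2 * c ^ 2 / 2) = L := by
          rw [hs, div_pow, ha2]
          field_simp
        rw [h5, h6]
        ring

end Azuma

theorem sum_Icc_one_eq_sum_range {M : Type*} [AddCommMonoid M] (f : ℕ → M) (n : ℕ) :
    ∑ i ∈ Finset.Icc 1 n, f i = ∑ i ∈ Finset.range n, f (i + 1) := by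
  induction n with
  | zero => simp
  | succ n ih => rw [Finset.sum_Icc_succ_top (by omega), ih, Finset.sum_range_succ]

/-! ### The algorithm as a non-anticipating function of the path -/

section Path
variable (vmax ρ : ℝ) (T : ℕ)

/-- State of OGD-CB after `n` rounds on the path `h` of pairs (value, competing bid). -/
noncomputable def pathState (h : ℕ → ℝ × ℝ) (n : ℕ) : State :=
  stateAfter vmax ρ T (fun t => (h t).1) (fun t => (h t).2) n

open Classical in
/-- Indicator that the main loop has not been left after `n` rounds. -/
noncomputable def alive (n : ℕ) (h : ℕ → ℝ × ℝ) : ℝ :=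
  if (pathState vmax ρ T h n).halted then 0 else 1

/-- Value of the pricing variable after `n` rounds. -/
noncomputable def price (n : ℕ) (h : ℕ → ℝ × ℝ) : ℝ := (pathState vmax ρ T h n).price

/-- Reward estimate at value `w` from the bids of the rounds `1, …, n`. -/
noncomputable def rewardUCB (n : ℕ) (h : ℕ → ℝ × ℝ) (w : ℝ) : ℝ :=
  rewardEst T (fun t => (h t).2) (Finset.Icc 1 n) w

/-- Cost estimate at value `w` from the bids of the rounds `1, …, n`. -/
noncomputable def costLCB (n : ℕ) (h : ℕ → ℝ × ℝ) (w : ℝ) : ℝ :=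
  costEst T (fun t => (h t).2) (Finset.Icc 1 n) w

open Classical in
/-- Decision in round `n + 1` at value `w`, given the path of the rounds `1, …, n`. -/
noncomputable def choice (n : ℕ) (h : ℕ → ℝ × ℝ) (w : ℝ) : ℝ :=
  if n = 0 then alive vmax ρ T n h
  else if price vmax ρ T n h * costLCB T n h w ≤ rewardUCB T n h w then alive vmax ρ T n h
  else 0

variable {vmax ρ T}

theorem pathState_succ (h : ℕ → ℝ × ℝ) (n : ℕ) :
    pathState vmax ρ T h (n + 1) =
      step vmax ρ T (fun t => (h t).1) (fun t => (h t).2) (n + 1) (pathState vmax ρ T h n) := rfl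

theorem alive_of_halted {h : ℕ → ℝ × ℝ} {n : ℕ} (hh : (pathState vmax ρ T h n).halted) :
    alive vmax ρ T n h = 0 := if_pos hh

theorem alive_of_not_halted {h : ℕ → ℝ × ℝ} {n : ℕ} (hh : ¬(pathState vmax ρ T h n).halted) :
    alive vmax ρ T n h = 1 := if_neg hh

theorem alive_eq_zero_or_one (n : ℕ) (h : ℕ → ℝ × ℝ) :
    alive vmax ρ T n h = 0 ∨ alive vmax ρ T n h = 1 := by
  unfold alive
  split_ifs <;> simp

theorem alive_zero (h : ℕ → ℝ × ℝ) : alive vmax ρ T 0 h = 1 :=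
  alive_of_not_halted (by simp [pathState, stateAfter, initState])

theorem choice_eq_zero_or_one (n : ℕ) (h : ℕ → ℝ × ℝ) (w : ℝ) :
    choice vmax ρ T n h w = 0 ∨ choice vmax ρ T n h w = 1 := by
  have := alive_eq_zero_or_one (vmax := vmax) (ρ := ρ) (T := T) n h
  unfold choice
  split_ifs <;> simp_all

theorem choice_of_alive_eq_zero {n : ℕ} {h : ℕ → ℝ × ℝ} (hh : alive vmax ρ T n h = 0) (w : ℝ) :
    choice vmax ρ T n h w = 0 := by
  unfold choice
  split_ifs <;> simp_all

/-- With full information the sample set is deterministic until the loop is left, which makes the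
estimates explicit averages. Afterwards the state is frozen and this fails. -/
theorem samples_of_not_halted (h : ℕ → ℝ × ℝ) (n : ℕ)
    (hn : ¬(pathState vmax ρ T h n).halted) :
    (pathState vmax ρ T h n).samples = Finset.Icc 1 n := by
  induction n with
  | zero => rfl
  | succ n ih =>
    by_cases hh : (pathState vmax ρ T h n).halted
    · rw [pathState_succ, step, if_pos hh] at hn
      exact absurd hh hn
    · rw [pathState_succ, step, if_neg hh]
      simp only [ih hh]
      ext i
      simp only [Finset.mem_insert, Finset.mem_Icc]
      omega

theorem action_pathState (h : ℕ → ℝ × ℝ) (n : ℕ) (w : ℝ) (hw : (h (n + 1)).1 = w) :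
    action T (fun t => (h t).1) (fun t => (h t).2) (n + 1) (pathState vmax ρ T h n) =
      choice vmax ρ T n h w := by
  subst hw
  by_cases hh : (pathState vmax ρ T h n).halted
  · rw [choice_of_alive_eq_zero (alive_of_halted hh), action, if_pos hh]
  · have hs := samples_of_not_halted h n hh
    rw [action, if_neg hh, hs, choice, alive_of_not_halted hh]
    simp only [Nat.add_eq_right]
    rfl

theorem decision_eq_choice (h : ℕ → ℝ × ℝ) (n : ℕ) :
    decision vmax ρ T (fun t => (h t).1) (fun t => (h t).2) (n + 1) =
      choice vmax ρ T n h (h (n + 1)).1 :=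
  action_pathState h n _ rfl

theorem revenue_eq_sum_choice (h : ℕ → ℝ × ℝ) :
    revenue vmax ρ T (fun t => (h t).1) (fun t => (h t).2) =
      ∑ i ∈ Finset.range T,
        choice vmax ρ T i h (h (i + 1)).1 * reward (h (i + 1)).1 (h (i + 1)).2 := by
  rw [revenue, sum_Icc_one_eq_sum_range]
  exact Finset.sum_congr rfl fun i _ => by rw [decision_eq_choice]

theorem price_zero (h : ℕ → ℝ × ℝ) : price vmax ρ T 0 h = 0 := rfl

theorem price_one (h : ℕ → ℝ × ℝ) : price vmax ρ T 1 h = 0 := by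
  simp [price, pathState, stateAfter, step, initState]

theorem price_succ_of_not_halted {h : ℕ → ℝ × ℝ} {n : ℕ} (hn : n ≠ 0)
    (hh : ¬(pathState vmax ρ T h n).halted) :
    price vmax ρ T (n + 1) h = max (price vmax ρ T n h + 1 / (vmax * Real.sqrt (n + 1 : ℕ)) *
      (choice vmax ρ T n h (h (n + 1)).1 * costLCB T n h (h (n + 1)).1 - ρ)) 0 := by
  have hs := samples_of_not_halted h n hh
  rw [← action_pathState h n _ rfl, price, pathState_succ, step, if_neg hh]
  simp only [Nat.add_eq_right, hn, if_false, hs]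
  rfl

theorem price_succ_of_halted {h : ℕ → ℝ × ℝ} {n : ℕ}
    (hh : (pathState vmax ρ T h n).halted) :
    price vmax ρ T (n + 1) h = price vmax ρ T n h := by
  rw [price, pathState_succ, step, if_pos hh, price]

theorem price_nonneg (n : ℕ) (h : ℕ → ℝ × ℝ) : 0 ≤ price vmax ρ T n h := by
  induction n with
  | zero => exact le_rfl
  | succ n ih =>
    by_cases hh : (pathState vmax ρ T h n).halted
    · rwa [price_succ_of_halted hh]
    · rcases eq_or_ne n 0 with rfl | hn
      · exact (price_one h).ge
      · rw [price_succ_of_not_halted hn hh]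
        exact le_max_right _ _

/-- The price makes a projected gradient step. -/
theorem price_succ {n : ℕ} (hn : n ≠ 0) (h : ℕ → ℝ × ℝ) :
    price vmax ρ T (n + 1) h = max (price vmax ρ T n h - 1 / (vmax * Real.sqrt (n + 1 : ℕ)) *
      (alive vmax ρ T n h *
        (ρ - choice vmax ρ T n h (h (n + 1)).1 * costLCB T n h (h (n + 1)).1))) 0 := by
  -- After halting the price is frozen, which the factor `alive` records as a zero gradient; the
  -- recursion thus needs no stopping time.
  by_cases hh : (pathState vmax ρ T h n).halted
  · rw [price_succ_of_halted hh, alive_of_halted hh, zero_mul, mul_zero, sub_zero,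
      max_eq_left (price_nonneg n h)]
  · rw [price_succ_of_not_halted hn hh, alive_of_not_halted hh]
    congr 1
    ring

theorem budget_eq (h : ℕ → ℝ × ℝ) (n : ℕ) :
    (pathState vmax ρ T h n).budget = ρ * T - ∑ i ∈ Finset.range n,
      choice vmax ρ T i h (h (i + 1)).1 * cost (h (i + 1)).1 (h (i + 1)).2 := by
  induction n with
  | zero => simp [pathState, stateAfter, initState]
  | succ n ih =>
    rw [Finset.sum_range_succ, pathState_succ, step]
    by_cases hh : (pathState vmax ρ T h n).halted
    · rw [if_pos hh, choice_of_alive_eq_zero (alive_of_halted hh), ih]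
      ring
    · rw [if_neg hh]
      simp only [action_pathState h n _ rfl, ih]
      ring

theorem halted_succ_iff (h : ℕ → ℝ × ℝ) (n : ℕ) :
    (pathState vmax ρ T h (n + 1)).halted ↔ (pathState vmax ρ T h n).halted ∨
      ρ * T - ∑ i ∈ Finset.range (n + 1),
        choice vmax ρ T i h (h (i + 1)).1 * cost (h (i + 1)).1 (h (i + 1)).2 < vmax := by
  by_cases hh : (pathState vmax ρ T h n).halted
  · simp [pathState_succ, step, hh]
  · rw [← budget_eq, pathState_succ, step, if_neg hh]
    simp [hh]

/-- Halting certifies that all but `vmax` of the budget is spent, and this persists because costs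
are nonnegative. -/
theorem lt_of_halted {h : ℕ → ℝ × ℝ} (hh : ∀ t, 0 ≤ (h t).2) {n : ℕ}
    (hn : (pathState vmax ρ T h n).halted) :
    ρ * T - ∑ i ∈ Finset.range n,
      choice vmax ρ T i h (h (i + 1)).1 * cost (h (i + 1)).1 (h (i + 1)).2 < vmax := by
  induction n with
  | zero => exact absurd hn (by simp [pathState, stateAfter, initState])
  | succ n ih =>
    rcases (halted_succ_iff h n).1 hn with h1 | h1
    · refine lt_of_le_of_lt ?_ (ih h1)
      rw [Finset.sum_range_succ]
      have : 0 ≤ choice vmax ρ T n h (h (n + 1)).1 * cost (h (n + 1)).1 (h (n + 1)).2 := by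
        refine mul_nonneg ?_ ?_
        · rcases choice_eq_zero_or_one (vmax := vmax) (ρ := ρ) (T := T) n h (h (n + 1)).1 with
            h2 | h2 <;> simp [h2]
        · unfold cost
          split_ifs <;> simp [hh]
      linarith
    · exact h1

theorem halted_mono {h : ℕ → ℝ × ℝ} {m n : ℕ} (hmn : m ≤ n)
    (hm : (pathState vmax ρ T h m).halted) : (pathState vmax ρ T h n).halted := by
  induction n, hmn using Nat.le_induction with
  | base => exact hm
  | succ n _ ih => exact (halted_succ_iff h n).2 (Or.inl ih)

theorem rewardUCB_congr {h h' : ℕ → ℝ × ℝ} {n : ℕ} (hh : ∀ s ∈ Finset.Icc 1 n, h s = h' s) :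
    rewardUCB T n h = rewardUCB T n h' := by
  funext w
  have hsum : ∑ s ∈ Finset.Icc 1 n, reward w (h s).2 = ∑ s ∈ Finset.Icc 1 n, reward w (h' s).2 :=
    Finset.sum_congr rfl fun s hs => by rw [hh s hs]
  unfold rewardUCB rewardEst
  rw [hsum]

theorem costLCB_congr {h h' : ℕ → ℝ × ℝ} {n : ℕ} (hh : ∀ s ∈ Finset.Icc 1 n, h s = h' s) :
    costLCB T n h = costLCB T n h' := by
  funext w
  have hsum : ∑ s ∈ Finset.Icc 1 n, cost w (h s).2 = ∑ s ∈ Finset.Icc 1 n, cost w (h' s).2 :=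
    Finset.sum_congr rfl fun s hs => by rw [hh s hs]
  unfold costLCB costEst
  rw [hsum]

theorem choice_congr_of_pathState_eq {h h' : ℕ → ℝ × ℝ} {n : ℕ}
    (hh : ∀ s ∈ Finset.Icc 1 n, h s = h' s)
    (hs : pathState vmax ρ T h n = pathState vmax ρ T h' n) :
    choice vmax ρ T n h = choice vmax ρ T n h' := by
  funext w
  unfold choice alive price
  rw [hs, rewardUCB_congr hh, costLCB_congr hh]

/-- Non-anticipation: it allows the path to be replaced by its truncation, the form of increment
required by the Azuma inequality. -/
theorem pathState_congr {h h' : ℕ → ℝ × ℝ} {n : ℕ} (hh : ∀ s ∈ Finset.Icc 1 n, h s = h' s) :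
    pathState vmax ρ T h n = pathState vmax ρ T h' n := by
  induction n with
  | zero => rfl
  | succ n ih =>
    have hn : ∀ s ∈ Finset.Icc 1 n, h s = h' s := fun s hs => hh s (by simp at hs ⊢; omega)
    specialize ih hn
    have hn1 : h (n + 1) = h' (n + 1) := hh _ (by simp)
    rw [pathState_succ, pathState_succ, step, step]
    by_cases hha : (pathState vmax ρ T h n).halted
    · rw [if_pos hha, if_pos (ih ▸ hha), ih]
    · have hhb : ¬(pathState vmax ρ T h' n).halted := by rwa [← ih]
      have hc : costEst T (fun t => (h t).2) (Finset.Icc 1 n) =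
          costEst T (fun t => (h' t).2) (Finset.Icc 1 n) := costLCB_congr hn
      rw [if_neg hha, if_neg hhb, action_pathState h n _ rfl, action_pathState h' n _ rfl,
        samples_of_not_halted h n hha, samples_of_not_halted h' n hhb,
        choice_congr_of_pathState_eq hn ih, ih, hn1, hc]

theorem eq_trunc {n s : ℕ} (h : ℕ → ℝ × ℝ) (hs : s ∈ Finset.Icc 1 n) : trunc n h s = h s :=
  trunc_apply_of_le (Finset.mem_Icc.1 hs).2 h

theorem alive_trunc (n : ℕ) (h : ℕ → ℝ × ℝ) :
    alive vmax ρ T n (trunc n h) = alive vmax ρ T n h := by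
  unfold alive
  rw [pathState_congr fun _ hs => eq_trunc h hs]

theorem price_trunc (n : ℕ) (h : ℕ → ℝ × ℝ) :
    price vmax ρ T n (trunc n h) = price vmax ρ T n h := by
  unfold price
  rw [pathState_congr fun _ hs => eq_trunc h hs]

theorem choice_trunc (n : ℕ) (h : ℕ → ℝ × ℝ) :
    choice vmax ρ T n (trunc n h) = choice vmax ρ T n h :=
  choice_congr_of_pathState_eq (fun _ hs => eq_trunc h hs)
    (pathState_congr fun _ hs => eq_trunc h hs)

theorem measurable_reward : Measurable fun z : ℝ × ℝ => reward z.1 z.2 := by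
  unfold reward
  fun_prop

theorem measurable_cost : Measurable fun z : ℝ × ℝ => cost z.1 z.2 := by
  unfold cost
  exact Measurable.ite (measurableSet_le measurable_snd measurable_fst) measurable_snd
    measurable_const

theorem measurable_rewardUCB (n : ℕ) :
    Measurable fun q : (ℕ → ℝ × ℝ) × ℝ => rewardUCB T n q.1 q.2 := by
  unfold rewardUCB rewardEst
  refine Measurable.add (Measurable.div_const (Finset.measurable_sum _ fun i _ => ?_) _)
    (measurable_snd.const_mul _)
  exact measurable_reward.comp (measurable_snd.prodMk
    (measurable_snd.comp ((measurable_pi_apply i).comp measurable_fst)))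

theorem measurable_costLCB (n : ℕ) :
    Measurable fun q : (ℕ → ℝ × ℝ) × ℝ => costLCB T n q.1 q.2 := by
  unfold costLCB costEst
  refine Measurable.sub (Measurable.div_const (Finset.measurable_sum _ fun i _ => ?_) _)
    (measurable_snd.const_mul _)
  exact measurable_cost.comp (measurable_snd.prodMk
    (measurable_snd.comp ((measurable_pi_apply i).comp measurable_fst)))

theorem measurable_choice_of {n : ℕ} (ha : Measurable (alive vmax ρ T n))
    (hp : Measurable (price vmax ρ T n)) :
    Measurable fun q : (ℕ → ℝ × ℝ) × ℝ => choice vmax ρ T n q.1 q.2 := by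
  unfold choice
  refine Measurable.ite (MeasurableSet.const _) (ha.comp measurable_fst) (Measurable.ite
    (measurableSet_le ((hp.comp measurable_fst).mul (measurable_costLCB n))
      (measurable_rewardUCB n)) (ha.comp measurable_fst) measurable_const)

theorem measurable_next_value (n : ℕ) :
    Measurable fun h : ℕ → ℝ × ℝ => (h, (h (n + 1)).1) :=
  measurable_id.prodMk (measurable_fst.comp (measurable_pi_apply (n + 1)))

/-- The halting test involves the whole spending history, so the induction carries all earlier
rounds, and both functions together. -/
theorem measurable_alive_and_price (n : ℕ) :
    (∀ m ≤ n, Measurable (alive vmax ρ T m)) ∧ ∀ m ≤ n, Measurable (price vmax ρ T m) := by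
  induction n with
  | zero =>
    refine ⟨fun m hm => ?_, fun m hm => ?_⟩
    · obtain rfl : m = 0 := by omega
      simp only [funext (alive_zero (vmax := vmax) (ρ := ρ) (T := T)), measurable_const]
    · obtain rfl : m = 0 := by omega
      exact measurable_const
  | succ n ih =>
    obtain ⟨iha, ihp⟩ := ih
    have hch : ∀ m ≤ n, Measurable fun h => choice vmax ρ T m h (h (m + 1)).1 := fun m hm =>
      (measurable_choice_of (iha m hm) (ihp m hm)).comp (measurable_next_value m)
    refine ⟨fun m hm => ?_, fun m hm => ?_⟩
    · rcases Nat.lt_or_ge m (n + 1) with h1 | h1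
      · exact iha m (by omega)
      obtain rfl : m = n + 1 := by omega
      have heq : alive vmax ρ T (n + 1) = fun h => alive vmax ρ T n h *
          (if ρ * T - ∑ i ∈ Finset.range (n + 1), choice vmax ρ T i h (h (i + 1)).1 *
            cost (h (i + 1)).1 (h (i + 1)).2 < vmax then 0 else 1) := by
        funext h
        unfold alive
        rw [halted_succ_iff]
        split_ifs <;> simp_all
      rw [heq]
      refine (iha n le_rfl).mul (Measurable.ite (measurableSet_lt (Measurable.const_sub
        (Finset.measurable_sum _ fun i hi => ?_) _) measurable_const) measurable_const
        measurable_const)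
      exact (hch i (by simp at hi; omega)).mul (measurable_cost.comp (measurable_pi_apply (i + 1)))
    · rcases Nat.lt_or_ge m (n + 1) with h1 | h1
      · exact ihp m (by omega)
      obtain rfl : m = n + 1 := by omega
      rcases eq_or_ne n 0 with rfl | hn
      · have : price vmax ρ T (0 + 1) = fun _ => 0 := funext price_one
        rw [this]
        exact measurable_const
      · rw [funext (price_succ hn)]
        refine Measurable.max (Measurable.sub (ihp n le_rfl) (Measurable.const_mul
          ((iha n le_rfl).mul (Measurable.const_sub ((hch n le_rfl).mul ?_) _)) _)) measurable_const
        exact (measurable_costLCB n).comp (measurable_next_value n)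

theorem measurable_alive (n : ℕ) : Measurable (alive vmax ρ T n) :=
  (measurable_alive_and_price n).1 n le_rfl

theorem measurable_price (n : ℕ) : Measurable (price vmax ρ T n) :=
  (measurable_alive_and_price n).2 n le_rfl

theorem measurable_choice (n : ℕ) :
    Measurable fun q : (ℕ → ℝ × ℝ) × ℝ => choice vmax ρ T n q.1 q.2 :=
  measurable_choice_of (measurable_alive n) (measurable_price n)

end Path

/-! ### Elementary bounds and online gradient descent -/

theorem reward_mem_Icc {w p : ℝ} (hw : 0 ≤ w) (hp : 0 ≤ p) : reward w p ∈ Set.Icc 0 w :=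
  ⟨le_max_right _ _, max_le (by linarith) hw⟩

theorem cost_mem_Icc {w p : ℝ} (hw : 0 ≤ w) (hp : 0 ≤ p) : cost w p ∈ Set.Icc 0 w := by
  unfold cost
  split_ifs with h
  · exact ⟨hp, h⟩
  · exact ⟨le_rfl, hw⟩

theorem sum_div_card_mem_Icc {f : ℕ → ℝ} {w : ℝ} {n : ℕ} (hn : n ≠ 0)
    (hf : ∀ i ∈ Finset.Icc 1 n, f i ∈ Set.Icc 0 w) :
    (∑ i ∈ Finset.Icc 1 n, f i) / n ∈ Set.Icc 0 w := by
  have hn' : (0 : ℝ) < n := by exact_mod_cast Nat.pos_of_ne_zero hn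
  refine ⟨div_nonneg (Finset.sum_nonneg fun i hi => (hf i hi).1) hn'.le, ?_⟩
  rw [div_le_iff₀ hn']
  refine (Finset.sum_le_sum fun i hi => (hf i hi).2).trans (le_of_eq ?_)
  simp [mul_comm]

theorem sum_inv_sqrt_le (n : ℕ) :
    ∑ i ∈ Finset.Ico 1 n, 1 / Real.sqrt i ≤ 2 * Real.sqrt n := by
  have key : ∀ m : ℕ, ∑ i ∈ Finset.Ico 1 (m + 1), 1 / Real.sqrt i ≤ 2 * Real.sqrt m := by
    intro m
    induction m with
    | zero => simp
    | succ m ih =>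
      rw [Finset.sum_Ico_succ_top (by omega)]
      set a := Real.sqrt m
      set b := Real.sqrt (m + 1 : ℕ) with hb
      have ha2 : a ^ 2 = m := Real.sq_sqrt (Nat.cast_nonneg m)
      have hb2 : b ^ 2 = m + 1 := by rw [hb, Real.sq_sqrt (by positivity)]; push_cast; ring
      have hb0 : 0 < b := Real.sqrt_pos.2 (by positivity)
      have : 1 / b ≤ 2 * (b - a) := by
        rw [div_le_iff₀ hb0]
        nlinarith [sq_nonneg (b - a)]
      linarith
  cases n with
  | zero => simp
  | succ m => exact (key m).trans (by gcongr; simp)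

/-- The right-hand side telescopes: `1 / √n - 1 / √(n+1)` is at least `1 / (3 * n * √(n+1))`,
because `√(n+1) ≤ 2 * √n`. Only the bound by `3` is used later. -/
theorem sum_inv_mul_sqrt_le {n : ℕ} (hn : 1 ≤ n) :
    ∑ i ∈ Finset.Ico 1 n, 1 / ((i : ℝ) * Real.sqrt (i + 1 : ℕ)) ≤ 3 - 3 / Real.sqrt n := by
  induction n, hn using Nat.le_induction with
  | base => simp
  | succ n hn ih =>
    rw [Finset.sum_Ico_succ_top hn]
    have hn' : (1 : ℝ) ≤ n := by exact_mod_cast hn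
    set a := Real.sqrt n with ha
    set b := Real.sqrt (n + 1 : ℕ) with hb
    have ha2 : a ^ 2 = n := Real.sq_sqrt (by linarith)
    have hb2 : b ^ 2 = n + 1 := by rw [hb, Real.sq_sqrt (by positivity)]; push_cast; ring
    have ha0 : 1 ≤ a := Real.one_le_sqrt.2 hn'
    have hb0 : 0 < b := Real.sqrt_pos.2 (by positivity)
    have hba : b ≤ 2 * a := abs_le_of_sq_le_sq' (by nlinarith) (by positivity) |>.2
    have hab : 1 ≤ 3 * a * (b - a) := by nlinarith
    have : 1 / ((n : ℝ) * b) ≤ 3 / a - 3 / b := by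
      rw [← ha2, div_sub_div _ _ (by positivity) hb0.ne', div_le_div_iff₀ (by positivity)
        (by positivity)]
      nlinarith [mul_pos (show 0 < a by linarith) hb0]
    linarith

/-- Regret bound for projected online gradient descent on `[0, ∞)` with step sizes
`1 / (B √(n + 1))` whose iterates stay within distance `M` of the comparator `u`. -/
theorem sum_sub_mul_le_of_gradient_step {B M u : ℝ} (hB : 0 < B) (hu : 0 ≤ u) {T : ℕ} (hT : 1 ≤ T)
    {lam g : ℕ → ℝ} (hM : ∀ n, |lam n - u| ≤ M)
    (hstep : ∀ n, n ≠ 0 → lam (n + 1) =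
      max (lam n - 1 / (B * Real.sqrt (n + 1 : ℕ)) * g n) 0) :
    ∑ n ∈ Finset.Ico 1 T, (lam n - u) * g n + (lam T - u) ^ 2 * (B * Real.sqrt T / 2) ≤
      M ^ 2 * (B * Real.sqrt T / 2) +
        ∑ n ∈ Finset.Ico 1 T, g n ^ 2 / (2 * B * Real.sqrt (n + 1 : ℕ)) := by
  have hM2 : ∀ n, (lam n - u) ^ 2 ≤ M ^ 2 := fun n => sq_le_sq.2 ((hM n).trans (le_abs_self M))
  -- The weighted distance at the last iterate is kept on the left as a potential. Its weight grows
  -- with `n`, and `M ^ 2` times the growth pays for it.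
  induction T, hT using Nat.le_induction with
  | base =>
    have := hM2 1
    simp only [Finset.Ico_self, Finset.sum_empty, zero_add, add_zero]
    gcongr
  | succ n hn ih =>
    rw [Finset.sum_Ico_succ_top hn, Finset.sum_Ico_succ_top hn]
    set a := B * Real.sqrt n / 2 with ha
    set s := B * Real.sqrt (n + 1 : ℕ) with hs
    have hs0 : 0 < s := mul_pos hB (Real.sqrt_pos.2 (by positivity))
    have has : a ≤ s / 2 := by
      rw [ha, hs]
      gcongr
      simp
    have h1 : (lam (n + 1) - u) ^ 2 ≤ (lam n - 1 / s * g n - u) ^ 2 := by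
      rw [hstep n (by omega)]
      rcases le_total (lam n - 1 / s * g n) 0 with h | h
      · rw [max_eq_right h]
        nlinarith
      · rw [max_eq_left h]
    have h2 : (lam n - 1 / s * g n - u) ^ 2 * (s / 2) =
        (lam n - u) ^ 2 * (s / 2) - (lam n - u) * g n + g n ^ 2 / (2 * s) := by
      field_simp
      ring
    have h3 := mul_le_mul_of_nonneg_right h1 (show 0 ≤ s / 2 by positivity)
    have h4 : g n ^ 2 / (2 * s) = g n ^ 2 / (2 * B * Real.sqrt (n + 1 : ℕ)) := by
      rw [hs, mul_assoc]
    have h5 := mul_le_mul_of_nonneg_right (hM2 n) (show 0 ≤ s / 2 - a by linarith)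
    rw [← h4]
    nlinarith

/-! ### Bounds on prices, gradients and confidence radii -/

section Path
variable {vmax ρ : ℝ} {T : ℕ} {h : ℕ → ℝ × ℝ}

theorem radius_nonneg (n : ℕ) : 0 ≤ radius T n := Real.sqrt_nonneg _

/-- The path takes its values in `[0, vmax] × [0, vmax]`. -/
def InBox (vmax : ℝ) (h : ℕ → ℝ × ℝ) : Prop :=
  ∀ t, (h t).1 ∈ Set.Icc 0 vmax ∧ (h t).2 ∈ Set.Icc 0 vmax

theorem rewardUCB_eq (n : ℕ) (w : ℝ) :
    rewardUCB T n h w = (∑ i ∈ Finset.Icc 1 n, reward w (h i).2) / n + radius T n * w := by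
  simp [rewardUCB, rewardEst]

theorem costLCB_eq (n : ℕ) (w : ℝ) :
    costLCB T n h w = (∑ i ∈ Finset.Icc 1 n, cost w (h i).2) / n - 2 * radius T n * w := by
  simp [costLCB, costEst]

theorem InBox.rewardUCB_mem (hh : InBox vmax h) {n : ℕ} (hn : n ≠ 0) {w : ℝ} (hw : 0 ≤ w) :
    rewardUCB T n h w ∈ Set.Icc 0 (w + radius T n * w) := by
  have h1 := sum_div_card_mem_Icc hn fun i _ => reward_mem_Icc hw (hh i).2.1
  have h2 := mul_nonneg (radius_nonneg (T := T) n) hw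
  rw [rewardUCB_eq]
  exact ⟨add_nonneg h1.1 h2, by linarith [h1.2]⟩

theorem InBox.costLCB_mem (hh : InBox vmax h) {n : ℕ} (hn : n ≠ 0) {w : ℝ} (hw : 0 ≤ w) :
    costLCB T n h w ∈ Set.Icc (-(2 * radius T n * w)) (w - 2 * radius T n * w) := by
  have h1 := sum_div_card_mem_Icc hn fun i _ => cost_mem_Icc hw (hh i).2.1
  rw [costLCB_eq]
  exact ⟨by linarith [h1.1], by linarith [h1.2]⟩

/-- Upper bound for the pricing variable. -/
noncomputable def priceBound (vmax ρ : ℝ) : ℝ := 3 / 2 * (vmax / ρ) + 1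

theorem choice_cases {n : ℕ} (hn : n ≠ 0) (w : ℝ) (ha : alive vmax ρ T n h = 1) :
    (choice vmax ρ T n h w = 1 ∧ price vmax ρ T n h * costLCB T n h w ≤ rewardUCB T n h w) ∨
    (choice vmax ρ T n h w = 0 ∧ rewardUCB T n h w < price vmax ρ T n h * costLCB T n h w) := by
  unfold choice
  rw [if_neg hn, ha]
  split_ifs with h1
  · exact Or.inl ⟨rfl, h1⟩
  · exact Or.inr ⟨rfl, not_le.1 h1⟩

/-- The price can rise only after entering with `c̃ > ρ > 0`. Positivity of `c̃` forces a radius at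
most `1/2`, hence `r̃ ≤ 3/2 * vmax`, and the entry test `λ * c̃ ≤ r̃` gives `λ ≤ 3/2 * (vmax / ρ)`.
One step adds at most `1`. -/
theorem InBox.price_le (hh : InBox vmax h) (hρ : 0 < ρ) (hv : 0 < vmax) (n : ℕ) :
    price vmax ρ T n h ≤ priceBound vmax ρ := by
  have hpos : 0 ≤ priceBound vmax ρ := by unfold priceBound; positivity
  induction n with
  | zero => exact hpos
  | succ n ih =>
    rcases eq_or_ne n 0 with rfl | hn
    · rw [price_one]
      exact hpos
    rw [price_succ hn]
    refine max_le ?_ hpos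
    set w := (h (n + 1)).1
    have hw : w ∈ Set.Icc 0 vmax := (hh (n + 1)).1
    have hη : 0 < vmax * Real.sqrt (n + 1 : ℕ) := mul_pos hv (Real.sqrt_pos.2 (by positivity))
    rcases alive_eq_zero_or_one (vmax := vmax) (ρ := ρ) (T := T) n h with ha | ha
    · simpa [ha] using ih
    rw [ha, one_mul]
    rcases choice_cases hn w ha with ⟨hx, hle⟩ | ⟨hx, -⟩
    · rw [hx, one_mul]
      rcases le_or_gt (costLCB T n h w) ρ with hc | hc
      · have := mul_nonneg (one_div_pos.2 hη).le (sub_nonneg.2 hc)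
        linarith
      have hcm := hh.costLCB_mem (T := T) hn hw.1
      have hrm := hh.rewardUCB_mem (T := T) hn hw.1
      have hε := radius_nonneg (T := T) n
      have hεw : radius T n * w ≤ w / 2 := by nlinarith [hcm.2]
      have hr : rewardUCB T n h w ≤ 3 / 2 * vmax := by linarith [hrm.2, hw.2]
      have hp0 := price_nonneg (vmax := vmax) (ρ := ρ) (T := T) n h
      have hp : price vmax ρ T n h ≤ 3 / 2 * (vmax / ρ) := by
        rw [← mul_div_assoc, le_div_iff₀ hρ]
        nlinarith
      have hcv : costLCB T n h w ≤ vmax := by nlinarith [hcm.2, hw.2, mul_nonneg hε hw.1]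
      have h1 : 1 / (vmax * Real.sqrt (n + 1 : ℕ)) * (costLCB T n h w - ρ) ≤ 1 := by
        rw [one_div, inv_mul_le_iff₀ hη, mul_one]
        have : (1 : ℝ) ≤ Real.sqrt (n + 1 : ℕ) := Real.one_le_sqrt.2 (by simp)
        nlinarith
      unfold priceBound
      linarith
    · rw [hx, zero_mul, sub_zero]
      have := mul_nonneg (one_div_pos.2 hη).le hρ.le
      linarith

/-- The gradient used to update the price after round `n + 1`. -/
noncomputable def gradient (vmax ρ : ℝ) (T n : ℕ) (h : ℕ → ℝ × ℝ) : ℝ :=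
  alive vmax ρ T n h * (ρ - choice vmax ρ T n h (h (n + 1)).1 * costLCB T n h (h (n + 1)).1)

theorem InBox.gradient_sq_le (hh : InBox vmax h) (hρ : 0 < ρ) (hρv : ρ ≤ vmax) {n : ℕ}
    (hn : n ≠ 0) : gradient vmax ρ T n h ^ 2 ≤ 8 * vmax ^ 2 * (1 + radius T n ^ 2) := by
  set w := (h (n + 1)).1 with hwdef
  have hw : w ∈ Set.Icc 0 vmax := (hh (n + 1)).1
  have hcm := hh.costLCB_mem (T := T) hn hw.1
  have hε := radius_nonneg (T := T) n
  have hεw : radius T n * w ≤ radius T n * vmax := mul_le_mul_of_nonneg_left hw.2 hε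
  have hεw0 : 0 ≤ radius T n * w := mul_nonneg hε hw.1
  have hv : 0 < vmax := hρ.trans_le hρv
  have habs : |gradient vmax ρ T n h| ≤ 2 * vmax * (1 + radius T n) := by
    unfold gradient
    rw [← hwdef]
    have h0 : 0 ≤ 2 * vmax * (1 + radius T n) := by positivity
    rcases alive_eq_zero_or_one (vmax := vmax) (ρ := ρ) (T := T) n h with ha | ha
    · rw [ha]
      simpa using h0
    rcases choice_eq_zero_or_one (vmax := vmax) (ρ := ρ) (T := T) n h w with hx | hx
    · rw [ha, hx, abs_le]
      constructor <;> nlinarith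
    · rw [ha, hx, abs_le]
      constructor <;> nlinarith [hcm.1, hcm.2, hw.2]
  have h2 : gradient vmax ρ T n h ^ 2 ≤ (2 * vmax * (1 + radius T n)) ^ 2 :=
    sq_le_sq.2 (habs.trans (le_abs_self _))
  nlinarith [mul_nonneg (sq_nonneg vmax) (sq_nonneg (1 - radius T n))]

theorem radius_eq (n : ℕ) :
    radius T n = Real.sqrt ((Real.log 2 + 2 * Real.log T) / 2) * (1 / Real.sqrt n) := by
  unfold radius
  rw [← div_div, Real.sqrt_div' _ (Nat.cast_nonneg n), mul_one_div]

theorem logTerm_nonneg (T : ℕ) : 0 ≤ Real.log 2 + 2 * Real.log T :=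
  add_nonneg (Real.log_nonneg one_le_two) (mul_nonneg zero_le_two (Real.log_natCast_nonneg T))

theorem radius_sq (n : ℕ) :
    radius T n ^ 2 = (Real.log 2 + 2 * Real.log T) / (2 * n) :=
  Real.sq_sqrt (div_nonneg (logTerm_nonneg T) (by positivity))

theorem sum_radius_le :
    ∑ n ∈ Finset.Ico 1 T, radius T n ≤ Real.sqrt (2 * T * (Real.log 2 + 2 * Real.log T)) := by
  calc ∑ n ∈ Finset.Ico 1 T, radius T n
      = Real.sqrt ((Real.log 2 + 2 * Real.log T) / 2) *
          ∑ n ∈ Finset.Ico 1 T, 1 / Real.sqrt n := by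
        rw [Finset.mul_sum]
        exact Finset.sum_congr rfl fun n _ => radius_eq n
    _ ≤ Real.sqrt ((Real.log 2 + 2 * Real.log T) / 2) * (2 * Real.sqrt T) := by
        gcongr
        exact sum_inv_sqrt_le T
    _ = _ := by
        have h4 : (2 : ℝ) = Real.sqrt 4 := by
          rw [show (4 : ℝ) = 2 ^ 2 by norm_num, Real.sqrt_sq zero_le_two]
        rw [h4, ← Real.sqrt_mul (by norm_num), ← h4, ← Real.sqrt_mul
          (div_nonneg (logTerm_nonneg T) zero_le_two)]
        congr 1
        ring

/-- For few samples the radius, and so the gradient, may be as large as `√(log T)`. As the squared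
radius decays like `log T / n`, its contribution is `log T` times the convergent sum of `1 / (n *
√(n+1))`. -/
theorem InBox.sum_gradient_le (hh : InBox vmax h) (hρ : 0 < ρ) (hρv : ρ ≤ vmax) (hT : 1 ≤ T)
    {u : ℝ} (hu : 0 ≤ u) :
    ∑ n ∈ Finset.Ico 1 T, (price vmax ρ T n h - u) * gradient vmax ρ T n h ≤
      (priceBound vmax ρ + u) ^ 2 * (vmax * Real.sqrt T / 2) +
        4 * vmax * (2 * Real.sqrt T + 3 / 2 * (Real.log 2 + 2 * Real.log T)) := by
  have hv : 0 < vmax := hρ.trans_le hρv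
  have h1 := sum_sub_mul_le_of_gradient_step hv hu hT (M := priceBound vmax ρ + u)
    (lam := fun n => price vmax ρ T n h) (g := fun n => gradient vmax ρ T n h)
    (fun n => by
      have h2 := hh.price_le (T := T) hρ hv n
      have h3 := price_nonneg (vmax := vmax) (ρ := ρ) (T := T) n h
      rw [abs_le]
      constructor <;> linarith) (fun n hn => price_succ hn h)
  have h2 : 0 ≤ (price vmax ρ T T h - u) ^ 2 * (vmax * Real.sqrt T / 2) := by positivity
  have h3 : ∑ n ∈ Finset.Ico 1 T, gradient vmax ρ T n h ^ 2 / (2 * vmax * Real.sqrt (n + 1 : ℕ)) ≤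
      ∑ n ∈ Finset.Ico 1 T, (4 * vmax * (1 / Real.sqrt n) +
        2 * vmax * (Real.log 2 + 2 * Real.log T) * (1 / ((n : ℝ) * Real.sqrt (n + 1 : ℕ)))) := by
    refine Finset.sum_le_sum fun n hn => ?_
    have hn1 : 1 ≤ n := (Finset.mem_Ico.1 hn).1
    have hn0 : (0 : ℝ) < n := by exact_mod_cast hn1
    set b := Real.sqrt (n + 1 : ℕ) with hb
    have hb0 : 0 < b := Real.sqrt_pos.2 (by positivity)
    have hab : 1 / b ≤ 1 / Real.sqrt n :=
      one_div_le_one_div_of_le (Real.sqrt_pos.2 hn0) (Real.sqrt_le_sqrt (by simp))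
    calc gradient vmax ρ T n h ^ 2 / (2 * vmax * b)
        ≤ 8 * vmax ^ 2 * (1 + radius T n ^ 2) / (2 * vmax * b) := by
          gcongr
          exact hh.gradient_sq_le hρ hρv (by omega)
      _ = 4 * vmax * (1 / b) +
          2 * vmax * (Real.log 2 + 2 * Real.log T) * (1 / ((n : ℝ) * b)) := by
          rw [radius_sq]
          field_simp
          ring
      _ ≤ _ := by gcongr
  rw [Finset.sum_add_distrib, ← Finset.mul_sum, ← Finset.mul_sum] at h3
  have h4 := sum_inv_sqrt_le T
  have h5 : ∑ n ∈ Finset.Ico 1 T, 1 / ((n : ℝ) * Real.sqrt (n + 1 : ℕ)) ≤ 3 :=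
    (sum_inv_mul_sqrt_le hT).trans (sub_le_self _ (by positivity))
  have h6 := mul_le_mul_of_nonneg_left h4 (show 0 ≤ 4 * vmax by positivity)
  have h7 := mul_le_mul_of_nonneg_left h5
    (mul_nonneg (show 0 ≤ 2 * vmax by positivity) (logTerm_nonneg T))
  linarith

end Path

/-! ### The regret bound on a fixed path -/

section Path
variable {vmax ρ : ℝ} {T : ℕ} {h : ℕ → ℝ × ℝ}

/-- One-round increment comparing the revenue of the rule `π`, with mean revenue `val`, to its
Lagrangian value at the current price. -/
noncomputable def lagrangeGap (vmax ρ : ℝ) (T : ℕ) (π R C : ℝ → ℝ) (val : ℝ) (n : ℕ)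
    (h : ℕ → ℝ × ℝ) (w : ℝ) : ℝ :=
  alive vmax ρ T n h * (val - π w * R w + price vmax ρ T n h * (π w * C w - ρ))

/-- Optimism and `λ ≥ 0` give `π * (R - λ * C) ≤ π * (r̃ - λ * c̃)`, which is at most `x * (r̃ - λ *
c̃)` by the choice of `x`. Passing back to true means costs two radii for the revenue and three,
weighted by `u`, for the cost. -/
theorem InBox.lagrange_step (hh : InBox vmax h) {π R C : ℝ → ℝ} {val u : ℝ} (hu : 0 ≤ u)
    {n : ℕ} (hn : n ≠ 0)
    (hπ : ∀ w ∈ Set.Icc 0 vmax, π w ∈ Set.Icc (0 : ℝ) 1)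
    (hR : |(∑ i ∈ Finset.Icc 1 n, reward (h (n + 1)).1 (h i).2) / n - R (h (n + 1)).1| ≤
      radius T n * (h (n + 1)).1)
    (hC : |(∑ i ∈ Finset.Icc 1 n, cost (h (n + 1)).1 (h i).2) / n - C (h (n + 1)).1| ≤
      radius T n * (h (n + 1)).1) :
    -((price vmax ρ T n h - u) * gradient vmax ρ T n h) - (3 * u + 2) * vmax * radius T n ≤
      choice vmax ρ T n h (h (n + 1)).1 * R (h (n + 1)).1 +
        lagrangeGap vmax ρ T π R C val n h (h (n + 1)).1 - val * alive vmax ρ T n h +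
        u * (ρ * alive vmax ρ T n h - choice vmax ρ T n h (h (n + 1)).1 * C (h (n + 1)).1) := by
  unfold gradient lagrangeGap
  set w := (h (n + 1)).1
  have hw : w ∈ Set.Icc 0 vmax := (hh (n + 1)).1
  have hε := radius_nonneg (T := T) n
  have hεw : radius T n * w ≤ radius T n * vmax := mul_le_mul_of_nonneg_left hw.2 hε
  have hεw0 : 0 ≤ radius T n * w := mul_nonneg hε hw.1
  have hr := rewardUCB_eq (T := T) (h := h) n w
  have hc := costLCB_eq (T := T) (h := h) n w
  rw [abs_le] at hR hC
  have hπw := hπ w hw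
  set r := rewardUCB T n h w
  set c := costLCB T n h w
  set lam := price vmax ρ T n h
  have hlam : 0 ≤ lam := price_nonneg n h
  have hr1 : R w ≤ r := by linarith [hR.1]
  have hr2 : r ≤ R w + 2 * (radius T n * vmax) := by linarith [hR.2]
  have hc1 : c ≤ C w := by linarith [hC.2]
  have hc2 : C w - 3 * (radius T n * vmax) ≤ c := by linarith [hC.1]
  have hslack : 0 ≤ radius T n * vmax := hεw0.trans hεw
  rcases alive_eq_zero_or_one (vmax := vmax) (ρ := ρ) (T := T) n h with ha | ha
  · rw [choice_of_alive_eq_zero ha, ha]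
    nlinarith
  have hlag : π w * (R w - lam * C w) ≤ π w * (r - lam * c) :=
    mul_le_mul_of_nonneg_left (by nlinarith) hπw.1
  rcases choice_cases hn w ha with ⟨hx, hle⟩ | ⟨hx, hle⟩
  · have h1 : π w * (r - lam * c) ≤ r - lam * c :=
      mul_le_of_le_one_left (by linarith) hπw.2
    have h2 := mul_le_mul_of_nonneg_left hc2 hu
    rw [hx, ha]
    linarith
  · have h1 : π w * (r - lam * c) ≤ 0 :=
      mul_nonpos_of_nonneg_of_nonpos hπw.1 (by linarith)
    have h2 := mul_nonneg hu hslack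
    rw [hx, ha]
    linarith

/-- Regret bound on a path on which the estimates and three sums of increments concentrate. -/
theorem InBox.regret_le (hh : InBox vmax h) (hρ : 0 < ρ) (hρv : ρ ≤ vmax) (hT : 1 ≤ T)
    {π R C : ℝ → ℝ} {val K K' : ℝ} (hval : val ∈ Set.Icc 0 vmax) (hK : 0 ≤ K)
    (hπ : ∀ w ∈ Set.Icc 0 vmax, π w ∈ Set.Icc (0 : ℝ) 1)
    (hR0 : ∀ w ∈ Set.Icc 0 vmax, 0 ≤ R w) (hC0 : ∀ w ∈ Set.Icc 0 vmax, C w ≤ w)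
    (hR : ∀ n ∈ Finset.Ico 1 T,
      |(∑ i ∈ Finset.Icc 1 n, reward (h (n + 1)).1 (h i).2) / n - R (h (n + 1)).1| ≤
        radius T n * (h (n + 1)).1)
    (hC : ∀ n ∈ Finset.Ico 1 T,
      |(∑ i ∈ Finset.Icc 1 n, cost (h (n + 1)).1 (h i).2) / n - C (h (n + 1)).1| ≤
        radius T n * (h (n + 1)).1)
    (h1 : ∑ n ∈ Finset.range T, choice vmax ρ T n h (h (n + 1)).1 *
      (R (h (n + 1)).1 - reward (h (n + 1)).1 (h (n + 1)).2) ≤ K)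
    (h2 : ∑ n ∈ Finset.range T, choice vmax ρ T n h (h (n + 1)).1 *
      (cost (h (n + 1)).1 (h (n + 1)).2 - C (h (n + 1)).1) ≤ K)
    (h3 : ∑ n ∈ Finset.range T, lagrangeGap vmax ρ T π R C val n h (h (n + 1)).1 ≤ K') :
    val * T - revenue vmax ρ T (fun t => (h t).1) (fun t => (h t).2) ≤
      K + K' + vmax / ρ * (2 * vmax + K) +
      ((priceBound vmax ρ + vmax / ρ) ^ 2 * (vmax * Real.sqrt T / 2) +
        4 * vmax * (2 * Real.sqrt T + 3 / 2 * (Real.log 2 + 2 * Real.log T))) +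
      (3 * (vmax / ρ) + 2) * vmax * Real.sqrt (2 * T * (Real.log 2 + 2 * Real.log T)) := by
  have hv : 0 < vmax := hρ.trans_le hρv
  have hκ : 0 < vmax / ρ := div_pos hv hρ
  set x : ℕ → ℝ := fun n => choice vmax ρ T n h (h (n + 1)).1 with hx
  set A : ℕ → ℝ := fun n => alive vmax ρ T n h with hA
  set r : ℕ → ℝ := fun n => R (h (n + 1)).1 with hr
  set c : ℕ → ℝ := fun n => C (h (n + 1)).1 with hc
  set E := Real.sqrt (2 * T * (Real.log 2 + 2 * Real.log T))
  set G : ℝ → ℝ := fun u => (priceBound vmax ρ + u) ^ 2 * (vmax * Real.sqrt T / 2) +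
        4 * vmax * (2 * Real.sqrt T + 3 / 2 * (Real.log 2 + 2 * Real.log T)) with hG
  have hA1 : ∀ n, A n ≤ 1 := fun n => by
    rcases alive_eq_zero_or_one (vmax := vmax) (ρ := ρ) (T := T) n h with ha | ha <;>
      simp [hA, ha]
  have main : ∀ u, 0 ≤ u → val * ∑ n ∈ Finset.range T, A n -
      revenue vmax ρ T (fun t => (h t).1) (fun t => (h t).2) ≤
      u * (ρ * ∑ n ∈ Finset.range T, A n - ∑ n ∈ Finset.range T, x n * c n) + K + K' +
        u * vmax + G u + (3 * u + 2) * vmax * E := by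
    intro u hu
    -- Round 1 has no estimates and no price step: it enters at price `0`, losing at most `u * vmax`
    -- in the comparison.
    have hQ0 : -(u * vmax) ≤ x 0 * r 0 + lagrangeGap vmax ρ T π R C val 0 h (h (0 + 1)).1 -
        val * A 0 + u * (ρ * A 0 - x 0 * c 0) := by
      have hw := (hh (0 + 1)).1
      have hA0 : A 0 = 1 := alive_zero h
      have hx0 : x 0 = 1 := by simp only [hx, choice, if_true]; exact hA0
      unfold lagrangeGap
      rw [price_zero, hx0, hA0, alive_zero]
      have h4 : π (h (0 + 1)).1 * R (h (0 + 1)).1 ≤ R (h (0 + 1)).1 :=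
        mul_le_of_le_one_left (hR0 _ hw) (hπ _ hw).2
      have h5 : u * C (h (0 + 1)).1 ≤ u * vmax :=
        mul_le_mul_of_nonneg_left ((hC0 _ hw).trans hw.2) hu
      have h6 := mul_nonneg hu hρ.le
      simp only [hr, hc]
      linarith
    have hsum : -(u * vmax) + ∑ n ∈ Finset.Ico 1 T,
        (-((price vmax ρ T n h - u) * gradient vmax ρ T n h) - (3 * u + 2) * vmax * radius T n) ≤
        ∑ n ∈ Finset.range T, (x n * r n + lagrangeGap vmax ρ T π R C val n h (h (n + 1)).1 -
          val * A n + u * (ρ * A n - x n * c n)) := by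
      conv_rhs => rw [Finset.range_eq_Ico, Finset.sum_eq_sum_Ico_succ_bot (show 0 < T by omega)]
      refine add_le_add hQ0 (Finset.sum_le_sum fun n hn => ?_)
      exact hh.lagrange_step hu (by simp at hn; omega) hπ (hR n hn) (hC n hn)
    simp only [Finset.sum_add_distrib, Finset.sum_sub_distrib, Finset.sum_neg_distrib,
      ← Finset.mul_sum] at hsum
    have h4 := hh.sum_gradient_le hρ hρv hT hu
    have h5 := mul_le_mul_of_nonneg_left (sum_radius_le (T := T))
      (show 0 ≤ (3 * u + 2) * vmax by positivity)
    have h6 : ∑ n ∈ Finset.range T, x n * r n ≤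
        revenue vmax ρ T (fun t => (h t).1) (fun t => (h t).2) + K := by
      simp only [mul_sub, Finset.sum_sub_distrib] at h1
      rw [revenue_eq_sum_choice]
      linarith
    simp only [hG]
    linarith
  by_cases hall : ∀ n < T, ¬(pathState vmax ρ T h n).halted
  · have hAT : ∑ n ∈ Finset.range T, A n = T := by
      rw [Finset.sum_congr rfl fun n hn =>
        alive_of_not_halted (hall n (Finset.mem_range.1 hn))]
      simp
    -- No early halt: the comparator `u = 0` drops the budget term.
    have h4 := main 0 le_rfl
    rw [hAT] at h4
    have h5 : G 0 ≤ G (vmax / ρ) := by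
      simp only [hG]
      have : 0 ≤ priceBound vmax ρ := by unfold priceBound; positivity
      gcongr
    have h6 : 0 ≤ vmax / ρ * (2 * vmax + K) := by positivity
    have h7 : 0 ≤ 3 * (vmax / ρ) * vmax * E := by positivity
    change _ ≤ K + K' + vmax / ρ * (2 * vmax + K) + G (vmax / ρ) +
      (3 * (vmax / ρ) + 2) * vmax * E
    linarith
  · push Not at hall
    obtain ⟨n, hn, hhalt⟩ := hall
    -- Early halt: with `u = vmax / ρ` the budget term is at most `-vmax` per missed round up to
    -- `vmax / ρ * (vmax + K)`, and `val ≤ vmax` makes this cover the missed revenue.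
    have hspent := lt_of_halted (fun t => (hh t).2.1) (halted_mono hn.le hhalt)
    have h4 := main (vmax / ρ) hκ.le
    have h5 : ∑ n ∈ Finset.range T, A n ≤ T :=
      (Finset.sum_le_sum fun n _ => hA1 n).trans (by simp)
    simp only [mul_sub, Finset.sum_sub_distrib] at h2
    have h6 : ρ * T - vmax - K ≤ ∑ n ∈ Finset.range T, x n * c n := by linarith
    have h7 := mul_le_mul_of_nonneg_left h6 hκ.le
    have h8 : vmax / ρ * ρ = vmax := div_mul_cancel₀ _ hρ.ne'
    have h9 := mul_nonneg (sub_nonneg.2 hval.2) (sub_nonneg.2 h5)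
    have h10 : vmax / ρ * (ρ * T - vmax - K) = vmax * T - vmax / ρ * (vmax + K) := by
      linear_combination (T : ℝ) * h8
    have h11 : vmax / ρ * (ρ * ∑ n ∈ Finset.range T, A n - ∑ n ∈ Finset.range T, x n * c n) =
        vmax * ∑ n ∈ Finset.range T, A n - vmax / ρ * ∑ n ∈ Finset.range T, x n * c n := by
      linear_combination (∑ n ∈ Finset.range T, A n) * h8
    rw [h11] at h4
    rw [h10] at h7
    change _ ≤ K + K' + vmax / ρ * (2 * vmax + K) + G (vmax / ρ) +
      (3 * (vmax / ρ) + 2) * vmax * E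
    linarith

end Path

/-! ### Conditioning on the next round and means over the bid -/

theorem IIDPath.measure_le_of_ae {Ω E : Type*} [MeasurableSpace Ω] [MeasurableSpace E] [Zero E]
    {μ : Measure Ω} [IsProbabilityMeasure μ] {ν : Measure E} [IsProbabilityMeasure ν] {T : ℕ}
    {Z : Ω → ℕ → E} (hZ : IIDPath μ ν T Z) {n : ℕ} (hn : n < T) {S : Set ((ℕ → E) × E)}
    (hS : MeasurableSet S) {δ : ENNReal} (h : ∀ᵐ z ∂ν, μ {ω | (trunc n (Z ω), z) ∈ S} ≤ δ) :
    μ {ω | (trunc n (Z ω), Z ω (n + 1)) ∈ S} ≤ δ := by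
  have hX : Measurable fun ω => trunc n (Z ω) := (measurable_trunc n).comp hZ.measurable
  have hY : Measurable fun ω => Z ω (n + 1) := (measurable_pi_apply _).comp hZ.measurable
  have h1 := (hZ.indep n hn).map_prod_eq_prod_map_map hX.aemeasurable hY.aemeasurable
  rw [hZ.law n hn] at h1
  have : IsProbabilityMeasure (μ.map fun ω => trunc n (Z ω)) :=
    Measure.isProbabilityMeasure_map hX.aemeasurable
  calc μ {ω | (trunc n (Z ω), Z ω (n + 1)) ∈ S}
      = (μ.map fun ω => (trunc n (Z ω), Z ω (n + 1))) S :=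
        (Measure.map_apply (hX.prodMk hY) hS).symm
    _ = ∫⁻ z, μ {ω | (trunc n (Z ω), z) ∈ S} ∂ν := by
        rw [h1, Measure.prod_apply_symm hS]
        refine lintegral_congr fun z => ?_
        rw [Measure.map_apply hX (measurable_prodMk_right hS)]
        rfl
    _ ≤ ∫⁻ _, δ ∂ν := lintegral_mono_ae h
    _ = δ := by simp

/-- A measurable function of (value, competing bid) that lies between `0` and the value. -/
structure BoundedByValue (vmax : ℝ) (f : ℝ → ℝ → ℝ) : Prop where
  measurable : Measurable (Function.uncurry f)
  mem_Icc : ∀ w ∈ Set.Icc 0 vmax, ∀ p ∈ Set.Icc 0 vmax, f w p ∈ Set.Icc 0 w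

theorem boundedByValue_reward (vmax : ℝ) : BoundedByValue vmax reward :=
  ⟨measurable_reward, fun _ hw _ hp => reward_mem_Icc hw.1 hp.1⟩

theorem boundedByValue_cost (vmax : ℝ) : BoundedByValue vmax cost :=
  ⟨measurable_cost, fun _ hw _ hp => cost_mem_Icc hw.1 hp.1⟩

/-- Mean of `f w p` over the competing bid `p`. -/
noncomputable def bidMean (G : Measure ℝ) (f : ℝ → ℝ → ℝ) (w : ℝ) : ℝ := ∫ p, f w p ∂G

theorem ae_prod_mem {vmax : ℝ} {F G : Measure ℝ}
    (hF : ∀ᵐ x ∂F, x ∈ Set.Icc 0 vmax) (hG : ∀ᵐ x ∂G, x ∈ Set.Icc 0 vmax) :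
    ∀ᵐ z ∂(F.prod G), z.1 ∈ Set.Icc 0 vmax ∧ z.2 ∈ Set.Icc 0 vmax :=
  (Measure.quasiMeasurePreserving_fst.ae hF).and (Measure.quasiMeasurePreserving_snd.ae hG)

theorem integral_comp_fst {F G : Measure ℝ} [SFinite F] [IsProbabilityMeasure G] (φ : ℝ → ℝ) (hφ : Measurable φ) :
    ∫ z, φ z.1 ∂(F.prod G) = ∫ w, φ w ∂F := by
  rw [← integral_map (μ := F.prod G) (φ := Prod.fst) (f := φ) measurable_fst.aemeasurable
    hφ.aestronglyMeasurable, Measure.map_fst_prod]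
  simp

section Mean
variable {vmax : ℝ} {F G : Measure ℝ} [IsProbabilityMeasure F] [IsProbabilityMeasure G]
  {f : ℝ → ℝ → ℝ}

theorem BoundedByValue.measurable_bidMean (hf : BoundedByValue vmax f) :
    Measurable (bidMean G f) :=
  (hf.measurable.stronglyMeasurable.integral_prod_right).measurable

theorem BoundedByValue.integrable (hf : BoundedByValue vmax f)
    (hG : ∀ᵐ x ∂G, x ∈ Set.Icc 0 vmax) {w : ℝ} (hw : w ∈ Set.Icc 0 vmax) :
    Integrable (f w) G :=
  Integrable.of_mem_Icc 0 w (hf.measurable.comp measurable_prodMk_left).aemeasurable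
    (hG.mono fun p hp => hf.mem_Icc w hw p hp)

theorem BoundedByValue.bidMean_mem (hf : BoundedByValue vmax f)
    (hG : ∀ᵐ x ∂G, x ∈ Set.Icc 0 vmax) {w : ℝ} (hw : w ∈ Set.Icc 0 vmax) :
    bidMean G f w ∈ Set.Icc 0 w := by
  refine ⟨integral_nonneg_of_ae (hG.mono fun p hp => (hf.mem_Icc w hw p hp).1), ?_⟩
  calc bidMean G f w ≤ ∫ _, w ∂G := integral_mono_ae (hf.integrable hG hw) (integrable_const w)
        (hG.mono fun p hp => (hf.mem_Icc w hw p hp).2)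
    _ = w := by simp

theorem BoundedByValue.integrable_mul (hf : BoundedByValue vmax f)
    (hF : ∀ᵐ x ∂F, x ∈ Set.Icc 0 vmax) (hG : ∀ᵐ x ∂G, x ∈ Set.Icc 0 vmax) {g : ℝ → ℝ}
    (hg : Measurable g) (hg1 : ∀ w ∈ Set.Icc 0 vmax, g w ∈ Set.Icc (0 : ℝ) 1) :
    Integrable (fun z : ℝ × ℝ => g z.1 * f z.1 z.2) (F.prod G) := by
  refine Integrable.of_mem_Icc 0 vmax
    ((hg.comp measurable_fst).mul hf.measurable).aemeasurable ?_
  filter_upwards [ae_prod_mem hF hG] with z hz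
  have h1 := hf.mem_Icc _ hz.1 _ hz.2
  have h2 := hg1 _ hz.1
  exact ⟨mul_nonneg h2.1 h1.1, (mul_le_of_le_one_left h1.1 h2.2).trans (h1.2.trans hz.1.2)⟩

theorem BoundedByValue.integral_mul_eq (hf : BoundedByValue vmax f)
    (hF : ∀ᵐ x ∂F, x ∈ Set.Icc 0 vmax) (hG : ∀ᵐ x ∂G, x ∈ Set.Icc 0 vmax) {g : ℝ → ℝ}
    (hg : Measurable g) (hg1 : ∀ w ∈ Set.Icc 0 vmax, g w ∈ Set.Icc (0 : ℝ) 1) :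
    ∫ z, g z.1 * f z.1 z.2 ∂(F.prod G) = ∫ w, g w * bidMean G f w ∂F := by
  rw [integral_prod _ (hf.integrable_mul hF hG hg hg1)]
  simp only [integral_const_mul, bidMean]

theorem BoundedByValue.integrable_mul_bidMean (hf : BoundedByValue vmax f)
    (hF : ∀ᵐ x ∂F, x ∈ Set.Icc 0 vmax) (hG : ∀ᵐ x ∂G, x ∈ Set.Icc 0 vmax) {g : ℝ → ℝ}
    (hg : Measurable g) (hg1 : ∀ w ∈ Set.Icc 0 vmax, g w ∈ Set.Icc (0 : ℝ) 1) :
    Integrable (fun w => g w * bidMean G f w) F := by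
  refine Integrable.of_mem_Icc 0 vmax (hg.mul hf.measurable_bidMean).aemeasurable ?_
  filter_upwards [hF] with w hw
  have h1 := hf.bidMean_mem hG hw
  have h2 := hg1 _ hw
  exact ⟨mul_nonneg h2.1 h1.1, (mul_le_of_le_one_left h1.1 h2.2).trans (h1.2.trans hw.2)⟩

end Mean

/-! ### Concentration of sums and estimates -/

section Concentration
variable {Ω : Type*} [MeasurableSpace Ω] {μ : Measure Ω} [IsProbabilityMeasure μ]
  {vmax ρ : ℝ} {F G : Measure ℝ} [IsProbabilityMeasure F] [IsProbabilityMeasure G]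
  {T : ℕ} {Z : Ω → ℕ → ℝ × ℝ} {f : ℝ → ℝ → ℝ}

/-- The weight `g` sees the value but not the bid, as a decision does; integrating over the bid
first gives zero. -/
theorem integral_sub_bidMean_eq_zero (hf : BoundedByValue vmax f)
    (hF : ∀ᵐ x ∂F, x ∈ Set.Icc 0 vmax) (hG : ∀ᵐ x ∂G, x ∈ Set.Icc 0 vmax) {g : ℝ → ℝ}
    (hg : Measurable g) (hg1 : ∀ w ∈ Set.Icc 0 vmax, g w ∈ Set.Icc (0 : ℝ) 1) (s : ℝ) :
    ∫ z, g z.1 * (s * (f z.1 z.2 - bidMean G f z.1)) ∂(F.prod G) = 0 := by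
  have h1 : ∀ z : ℝ × ℝ, g z.1 * (s * (f z.1 z.2 - bidMean G f z.1)) =
      s * (g z.1 * f z.1 z.2 - g z.1 * bidMean G f z.1) := fun z => by ring
  simp only [h1]
  rw [integral_const_mul, integral_sub (hf.integrable_mul hF hG hg hg1)
    ((hf.integrable_mul_bidMean hF hG hg hg1).comp_fst G), hf.integral_mul_eq hF hG hg hg1,
    integral_comp_fst (fun w => g w * bidMean G f w) (hg.mul hf.measurable_bidMean), sub_self,
    mul_zero]

/-- Concentration of the revenue or the cost of the entered auctions around the sum of its
conditional means. -/
theorem IIDPath.measure_sum_choice_gt_le (hZ : IIDPath μ (F.prod G) T Z) (hv : 0 < vmax) (hf : BoundedByValue vmax f)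
    (hF : ∀ᵐ x ∂F, x ∈ Set.Icc 0 vmax) (hG : ∀ᵐ x ∂G, x ∈ Set.Icc 0 vmax) {s : ℝ}
    (hs : s = 1 ∨ s = -1) {L : ℝ} (hL : 0 ≤ L) :
    μ {ω | vmax * Real.sqrt (2 * T * L) < ∑ n ∈ Finset.range T,
        choice vmax ρ T n (Z ω) (Z ω (n + 1)).1 *
          (s * (f (Z ω (n + 1)).1 (Z ω (n + 1)).2 - bidMean G f (Z ω (n + 1)).1))} ≤
      ENNReal.ofReal (Real.exp (-L)) := by
  have h1 := hZ.measure_sum_gt_le (D := fun n h z => choice vmax ρ T n h z.1 *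
      (s * (f z.1 z.2 - bidMean G f z.1))) hv hL le_rfl ?_ ?_ ?_
  · simpa only [choice_trunc] using h1
  · intro n _
    have hc : Measurable fun q : (ℕ → ℝ × ℝ) × ℝ × ℝ => choice vmax ρ T n q.1 q.2.1 :=
      (measurable_choice n).comp (measurable_fst.prodMk (measurable_fst.comp measurable_snd))
    exact hc.mul (((hf.measurable.comp measurable_snd).sub
      (hf.measurable_bidMean.comp (measurable_fst.comp measurable_snd))).const_mul s)
  · refine fun n _ ω => ⟨-vmax, ?_⟩
    filter_upwards [ae_prod_mem hF hG] with z hz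
    have h2 := hf.mem_Icc _ hz.1 _ hz.2
    have h3 := hf.bidMean_mem hG hz.1
    have h4 := hz.1.2
    rcases choice_eq_zero_or_one (vmax := vmax) (ρ := ρ) (T := T) n (trunc n (Z ω)) z.1 with
      hx | hx <;> rcases hs with rfl | rfl <;> rw [hx] <;> constructor <;>
      linarith [h2.1, h2.2, h3.1, h3.2]
  · intro n _ ω
    refine (integral_sub_bidMean_eq_zero hf hF hG
      (g := fun w => choice vmax ρ T n (trunc n (Z ω)) w)
      ((measurable_choice n).comp measurable_prodMk_left) (fun w _ => ?_) s).le
    rcases choice_eq_zero_or_one (vmax := vmax) (ρ := ρ) (T := T) n (trunc n (Z ω)) w with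
      hx | hx <;> simp [hx]

/-- At a fixed value `w` each term stays in an interval of length `w`; the half-width `w / 2` is
what the confidence radius is calibrated to. -/
theorem IIDPath.measure_sum_bid_gt_le (hZ : IIDPath μ (F.prod G) T Z) (hf : BoundedByValue vmax f)
    (hG : ∀ᵐ x ∂G, x ∈ Set.Icc 0 vmax) {s : ℝ} (hs : s = 1 ∨ s = -1) {L : ℝ} (hL : 0 ≤ L)
    {n : ℕ} (hn : n ≤ T) {w : ℝ} (hw : w ∈ Set.Icc 0 vmax) (hw0 : 0 < w) :
    μ {ω | w / 2 * Real.sqrt (2 * n * L) < ∑ i ∈ Finset.range n,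
        s * (f w (Z ω (i + 1)).2 - bidMean G f w)} ≤ ENNReal.ofReal (Real.exp (-L)) := by
  have hm := hf.bidMean_mem hG hw
  have hfw : Measurable (f w) := hf.measurable.comp measurable_prodMk_left
  refine hZ.measure_sum_gt_le (D := fun n h z => s * (f w z.2 - bidMean G f w))
    (half_pos hw0) hL hn ?_ ?_ ?_
  · intro i _
    exact ((hfw.comp (measurable_snd.comp measurable_snd)).sub_const _).const_mul s
  · intro i _ ω
    rcases hs with rfl | rfl
    · refine ⟨-bidMean G f w, ?_⟩
      filter_upwards [Measure.quasiMeasurePreserving_snd.ae hG] with z hz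
      have h2 := hf.mem_Icc _ hw _ hz
      constructor <;> linarith [h2.1, h2.2]
    · refine ⟨bidMean G f w - w, ?_⟩
      filter_upwards [Measure.quasiMeasurePreserving_snd.ae hG] with z hz
      have h2 := hf.mem_Icc _ hw _ hz
      constructor <;> linarith [h2.1, h2.2]
  · intro i _ ω
    have h3 : ∫ z, f w z.2 ∂(F.prod G) = bidMean G f w := by
      rw [← integral_map (μ := F.prod G) (φ := Prod.snd) (f := f w) measurable_snd.aemeasurable
        hfw.aestronglyMeasurable, Measure.map_snd_prod]
      simp [bidMean]
    rw [integral_const_mul, integral_sub ((hf.integrable hG hw).comp_snd F) (integrable_const _), h3]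
    simp

/-- Identifies a deviation of the mean by the radius with the Azuma threshold at level `L = log 2 +
2 * log T`; the `log 2` pays for two-sidedness. -/
theorem natCast_mul_radius (n : ℕ) :
    n * radius T n = 1 / 2 * Real.sqrt (2 * n * (Real.log 2 + 2 * Real.log T)) := by
  rcases Nat.eq_zero_or_pos n with rfl | hn
  · simp
  have hn' : (0 : ℝ) < n := by exact_mod_cast hn
  refine (sq_eq_sq₀ (mul_nonneg hn'.le (radius_nonneg n)) (by positivity)).1 ?_
  rw [mul_pow, mul_pow, radius_sq, Real.sq_sqrt (mul_nonneg (by positivity) (logTerm_nonneg T))]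
  field_simp

theorem exp_neg_two_mul_log (hT : 1 ≤ T) : Real.exp (-(2 * Real.log T)) = 1 / (T : ℝ) ^ 2 := by
  have hT' : (0 : ℝ) < T := by exact_mod_cast hT
  rw [Real.exp_neg, two_mul, Real.exp_add, Real.exp_log hT', one_div, sq]

theorem exp_neg_logTerm (hT : 1 ≤ T) :
    Real.exp (-(Real.log 2 + 2 * Real.log T)) = 1 / 2 * (1 / (T : ℝ) ^ 2) := by
  rw [neg_add, Real.exp_add, exp_neg_two_mul_log hT, Real.exp_neg, Real.exp_log two_pos, one_div 2]

/-- The empirical mean over `n` bids is within the confidence radius at a fixed value. -/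
theorem IIDPath.measure_estimate_le (hZ : IIDPath μ (F.prod G) T Z)
    (hbox : ∀ ω, InBox vmax (Z ω)) (hf : BoundedByValue vmax f)
    (hG : ∀ᵐ x ∂G, x ∈ Set.Icc 0 vmax) (hT : 1 ≤ T) {n : ℕ} (hn0 : n ≠ 0) (hn : n ≤ T) {w : ℝ}
    (hw : w ∈ Set.Icc 0 vmax) :
    μ {ω | radius T n * w < |(∑ i ∈ Finset.Icc 1 n, f w (Z ω i).2) / n - bidMean G f w|} ≤
      ENNReal.ofReal (1 / (T : ℝ) ^ 2) := by
  have hn' : (0 : ℝ) < n := by exact_mod_cast Nat.pos_of_ne_zero hn0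
  -- At `w = 0` the Azuma width degenerates, but all terms vanish.
  rcases hw.1.eq_or_lt with rfl | hw0
  · have hm := hf.bidMean_mem hG hw
    have h0 : ∀ ω, ∑ i ∈ Finset.Icc 1 n, f 0 (Z ω i).2 = 0 := fun ω =>
      Finset.sum_eq_zero fun i _ => by
        have := hf.mem_Icc _ hw _ (hbox ω i).2
        exact le_antisymm this.2 this.1
    simp [h0, le_antisymm hm.2 hm.1]
  have h1 := hZ.measure_sum_bid_gt_le hf hG (Or.inl rfl) (logTerm_nonneg T) hn hw hw0
  have h2 := hZ.measure_sum_bid_gt_le hf hG (Or.inr rfl) (logTerm_nonneg T) hn hw hw0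
  have hsub : {ω | radius T n * w <
      |(∑ i ∈ Finset.Icc 1 n, f w (Z ω i).2) / n - bidMean G f w|} ⊆
      {ω | w / 2 * Real.sqrt (2 * n * (Real.log 2 + 2 * Real.log T)) < ∑ i ∈ Finset.range n,
        1 * (f w (Z ω (i + 1)).2 - bidMean G f w)} ∪
      {ω | w / 2 * Real.sqrt (2 * n * (Real.log 2 + 2 * Real.log T)) < ∑ i ∈ Finset.range n,
        -1 * (f w (Z ω (i + 1)).2 - bidMean G f w)} := by
    intro ω hω
    rw [Set.mem_ofPred_eq] at hω
    have h3 : w / 2 * Real.sqrt (2 * n * (Real.log 2 + 2 * Real.log T)) =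
        n * (radius T n * w) := by
      linear_combination -w * natCast_mul_radius (T := T) n
    have h4 : ∑ i ∈ Finset.range n, (f w (Z ω (i + 1)).2 - bidMean G f w) =
        n * ((∑ i ∈ Finset.Icc 1 n, f w (Z ω i).2) / n - bidMean G f w) := by
      rw [Finset.sum_sub_distrib, sum_Icc_one_eq_sum_range, mul_sub, mul_div_cancel₀ _ hn'.ne']
      simp
    simp only [Set.mem_union, Set.mem_ofPred_eq, ← Finset.mul_sum, h3, h4]
    rcases lt_abs.1 hω with h5 | h5
    · left
      rw [one_mul]
      exact mul_lt_mul_of_pos_left h5 hn'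
    · right
      have := mul_lt_mul_of_pos_left h5 hn'
      linarith
  refine (measure_mono hsub).trans ((measure_union_le _ _).trans ((add_le_add h1 h2).trans ?_))
  rw [← ENNReal.ofReal_add (Real.exp_pos _).le (Real.exp_pos _).le, exp_neg_logTerm hT]
  exact ENNReal.ofReal_le_ofReal (by linarith)

/-- The empirical mean over the first `n` bids is within the confidence radius at the value of
the next round. -/
theorem IIDPath.measure_estimate_next_le (hZ : IIDPath μ (F.prod G) T Z)
    (hbox : ∀ ω, InBox vmax (Z ω)) (hf : BoundedByValue vmax f)
    (hF : ∀ᵐ x ∂F, x ∈ Set.Icc 0 vmax) (hG : ∀ᵐ x ∂G, x ∈ Set.Icc 0 vmax) {n : ℕ}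
    (hn0 : n ≠ 0) (hn : n < T) :
    μ {ω | radius T n * (Z ω (n + 1)).1 <
        |(∑ i ∈ Finset.Icc 1 n, f (Z ω (n + 1)).1 (Z ω i).2) / n -
          bidMean G f (Z ω (n + 1)).1|} ≤
      ENNReal.ofReal (1 / (T : ℝ) ^ 2) := by
  have hsum : ∀ ω w, ∑ i ∈ Finset.Icc 1 n, f w (trunc n (Z ω) i).2 =
      ∑ i ∈ Finset.Icc 1 n, f w (Z ω i).2 := fun ω w =>
    Finset.sum_congr rfl fun i hi => by rw [eq_trunc _ hi]
  have h1 := hZ.measure_le_of_ae hn (S := {q | radius T n * q.2.1 <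
    |(∑ i ∈ Finset.Icc 1 n, f q.2.1 (q.1 i).2) / n - bidMean G f q.2.1|})
    (δ := ENNReal.ofReal (1 / (T : ℝ) ^ 2)) ?_ ?_
  · simpa only [Set.mem_ofPred_eq, hsum] using h1
  · have hval : Measurable fun q : (ℕ → ℝ × ℝ) × ℝ × ℝ => q.2.1 :=
      measurable_fst.comp measurable_snd
    refine measurableSet_lt (hval.const_mul _) (Measurable.abs (Measurable.sub
      (Measurable.div_const (Finset.measurable_sum _ fun i _ => ?_) _)
      (hf.measurable_bidMean.comp hval)))
    exact hf.measurable.comp (hval.prodMk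
      (measurable_snd.comp ((measurable_pi_apply i).comp measurable_fst)))
  · filter_upwards [Measure.quasiMeasurePreserving_fst.ae hF] with z hz
    simp only [hsum]
    exact hZ.measure_estimate_le hbox hf hG (by omega) hn0 hn.le hz

/-- Given the past, `val - π * R` has mean zero and `π * C - ρ` has nonpositive mean by feasibility.
As the price is nonnegative and already determined, the increments have nonpositive mean; the price
bound gives their range. -/
theorem IIDPath.measure_sum_lagrangeGap_gt_le (hZ : IIDPath μ (F.prod G) T Z)
    (hbox : ∀ ω, InBox vmax (Z ω)) (hρ : 0 < ρ) (hρv : ρ ≤ vmax)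
    (hF : ∀ᵐ x ∂F, x ∈ Set.Icc 0 vmax) (hG : ∀ᵐ x ∂G, x ∈ Set.Icc 0 vmax) {π : ℝ → ℝ}
    (hπ : Feasible vmax ρ F G π) {L : ℝ} (hL : 0 ≤ L) :
    μ {ω | vmax * (1 + priceBound vmax ρ) * Real.sqrt (2 * T * L) <
        ∑ n ∈ Finset.range T, lagrangeGap vmax ρ T π (bidMean G reward) (bidMean G cost)
          (∫ z, π z.1 * reward z.1 z.2 ∂(F.prod G)) n (Z ω) (Z ω (n + 1)).1} ≤
      ENNReal.ofReal (Real.exp (-L)) := by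
  have hv : 0 < vmax := hρ.trans_le hρv
  have hpb : 0 ≤ priceBound vmax ρ := by unfold priceBound; positivity
  have hr := boundedByValue_reward vmax
  have hc := boundedByValue_cost vmax
  have hir := hr.integrable_mul_bidMean hF hG hπ.measurable hπ.mem_unit
  have hic := hc.integrable_mul_bidMean hF hG hπ.measurable hπ.mem_unit
  set val := ∫ z, π z.1 * reward z.1 z.2 ∂(F.prod G) with hvaldef
  have hval : val = ∫ w, π w * bidMean G reward w ∂F :=
    hr.integral_mul_eq hF hG hπ.measurable hπ.mem_unit
  have hcost : ∫ w, π w * bidMean G cost w ∂F ≤ ρ := by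
    rw [← hc.integral_mul_eq hF hG hπ.measurable hπ.mem_unit]
    exact hπ.cost_le
  have hmulR : ∀ w ∈ Set.Icc 0 vmax, π w * bidMean G reward w ∈ Set.Icc 0 vmax := fun w hw => by
    have h1 := hr.bidMean_mem hG hw
    have h2 := hπ.mem_unit w hw
    exact ⟨mul_nonneg h2.1 h1.1, (mul_le_of_le_one_left h1.1 h2.2).trans (h1.2.trans hw.2)⟩
  have hmulC : ∀ w ∈ Set.Icc 0 vmax, π w * bidMean G cost w ∈ Set.Icc 0 vmax := fun w hw => by
    have h1 := hc.bidMean_mem hG hw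
    have h2 := hπ.mem_unit w hw
    exact ⟨mul_nonneg h2.1 h1.1, (mul_le_of_le_one_left h1.1 h2.2).trans (h1.2.trans hw.2)⟩
  have hval_mem : val ∈ Set.Icc 0 vmax := by
    rw [hval]
    refine ⟨integral_nonneg_of_ae (hF.mono fun w hw => (hmulR w hw).1), ?_⟩
    calc _ ≤ ∫ _, vmax ∂F := integral_mono_ae hir (integrable_const _)
          (hF.mono fun w hw => (hmulR w hw).2)
      _ = vmax := by simp
  have hmR := hπ.measurable.mul (hr.measurable_bidMean (G := G))
  have hmC := hπ.measurable.mul (hc.measurable_bidMean (G := G))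
  have hmeas : ∀ n, Measurable fun q : (ℕ → ℝ × ℝ) × ℝ =>
      lagrangeGap vmax ρ T π (bidMean G reward) (bidMean G cost) val n q.1 q.2 := fun n =>
    ((measurable_alive n).comp measurable_fst).mul (((hmR.comp measurable_snd).const_sub val).add
      (((measurable_price n).comp measurable_fst).mul ((hmC.comp measurable_snd).sub_const ρ)))
  have htr : ∀ n h w, lagrangeGap vmax ρ T π (bidMean G reward) (bidMean G cost) val n
      (trunc n h) w = lagrangeGap vmax ρ T π (bidMean G reward) (bidMean G cost) val n h w := by
    intro n h w
    unfold lagrangeGap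
    rw [alive_trunc, price_trunc]
  have h1 := hZ.measure_sum_gt_le (D := fun n h z => lagrangeGap vmax ρ T π (bidMean G reward)
    (bidMean G cost) val n h z.1) (c := vmax * (1 + priceBound vmax ρ)) (by positivity) hL le_rfl
    ?_ ?_ ?_
  · simpa only [htr] using h1
  · exact fun n _ => (hmeas n).comp
      (measurable_fst.prodMk (measurable_fst.comp measurable_snd))
  · refine fun n _ ω => ⟨-(vmax * (1 + priceBound vmax ρ)), ?_⟩
    filter_upwards [ae_prod_mem hF hG] with z hz
    rw [htr]
    have hR := hmulR _ hz.1
    have hC := hmulC _ hz.1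
    have hp := (hbox ω).price_le (T := T) hρ hv n
    have hp0 := price_nonneg (vmax := vmax) (ρ := ρ) (T := T) n (Z ω)
    have h2 : |price vmax ρ T n (Z ω) * (π z.1 * bidMean G cost z.1 - ρ)| ≤
        priceBound vmax ρ * vmax := by
      rw [abs_mul, abs_of_nonneg hp0]
      refine mul_le_mul hp ?_ (abs_nonneg _) hpb
      rw [abs_le]
      constructor <;> linarith [hC.1, hC.2]
    rw [abs_le] at h2
    unfold lagrangeGap
    rcases alive_eq_zero_or_one (vmax := vmax) (ρ := ρ) (T := T) n (Z ω) with ha | ha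
    · rw [ha, zero_mul]
      constructor <;> nlinarith
    · rw [ha, one_mul]
      constructor <;> linarith [h2.1, h2.2, hR.1, hR.2, hval_mem.1, hval_mem.2]
  · intro n _ ω
    rw [integral_comp_fst (fun w => lagrangeGap vmax ρ T π (bidMean G reward) (bidMean G cost) val n
      (trunc n (Z ω)) w) ((hmeas n).comp measurable_prodMk_left)]
    simp only [htr]
    unfold lagrangeGap
    have hp0 := price_nonneg (vmax := vmax) (ρ := ρ) (T := T) n (Z ω)
    have hintR : Integrable (fun w => val - π w * bidMean G reward w) F :=
      (integrable_const _).sub hir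
    have hintC : Integrable (fun w => price vmax ρ T n (Z ω) *
        (π w * bidMean G cost w - ρ)) F := (hic.sub (integrable_const _)).const_mul _
    rw [integral_const_mul, integral_add hintR hintC, integral_sub (integrable_const _) hir,
      integral_const_mul, integral_sub hic (integrable_const _), ← hval]
    have h2 := mul_nonneg hp0 (sub_nonneg.2 hcost)
    rcases alive_eq_zero_or_one (vmax := vmax) (ρ := ρ) (T := T) n (Z ω) with ha | ha
    · simp [ha]
    · simp only [ha, integral_const, probReal_univ, smul_eq_mul, one_mul, sub_self, zero_add]
      linarith

end Concentration

/-! ### Absorbing the bound into a multiple of `√(T log T)` -/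

/-- Bound on the regret against a fixed feasible rule on the concentration event. -/
noncomputable def pathRegretBound (vmax ρ : ℝ) (T : ℕ) : ℝ :=
  vmax * Real.sqrt (2 * T * (2 * Real.log T)) +
      vmax * (1 + priceBound vmax ρ) * Real.sqrt (2 * T * (2 * Real.log T)) +
      vmax / ρ * (2 * vmax + vmax * Real.sqrt (2 * T * (2 * Real.log T))) +
      ((priceBound vmax ρ + vmax / ρ) ^ 2 * (vmax * Real.sqrt T / 2) +
        4 * vmax * (2 * Real.sqrt T + 3 / 2 * (Real.log 2 + 2 * Real.log T))) +
      (3 * (vmax / ρ) + 2) * vmax * Real.sqrt (2 * T * (Real.log 2 + 2 * Real.log T))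

/-- Constant in front of `√(T ln T)` in the bound on the regret against a fixed feasible rule. -/
noncomputable def pathRegretConst (vmax ρ : ℝ) : ℝ :=
  2 * vmax + 2 * vmax * (1 + priceBound vmax ρ) + vmax / ρ * (6 * vmax) +
    (priceBound vmax ρ + vmax / ρ) ^ 2 * vmax + 34 * vmax + (3 * (vmax / ρ) + 2) * vmax * 3

theorem one_le_two_mul_sqrt_mul_log {T : ℕ} (hT : 2 ≤ T) :
    1 ≤ 2 * Real.sqrt (T * Real.log T) := by
  have hT' : (2 : ℝ) ≤ T := by exact_mod_cast hT
  have hlog : 1 / 2 ≤ Real.log T := by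
    linarith [Real.log_two_gt_d9, Real.log_le_log two_pos hT']
  have : (1 : ℝ) ≤ Real.sqrt (T * Real.log T) := Real.one_le_sqrt.2 (by nlinarith)
  linarith

theorem pathRegretBound_le {vmax ρ : ℝ} (hρ : 0 < ρ) (hρv : ρ ≤ vmax) {T : ℕ} (hT : 2 ≤ T) :
    pathRegretBound vmax ρ T ≤ pathRegretConst vmax ρ * Real.sqrt (T * Real.log T) := by
  have hv : 0 < vmax := hρ.trans_le hρv
  have hκ : 0 < vmax / ρ := div_pos hv hρ
  have hpb : 0 ≤ priceBound vmax ρ := by unfold priceBound; positivity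
  have hT' : (2 : ℝ) ≤ T := by exact_mod_cast hT
  have hlog2 : Real.log 2 ≤ Real.log T := Real.log_le_log two_pos hT'
  have hlog : 1 / 2 ≤ Real.log T := by linarith [Real.log_two_gt_d9]
  have hlogT : Real.log T ≤ T := (Real.log_le_sub_one_of_pos (by linarith)).trans (by linarith)
  have h1 := one_le_two_mul_sqrt_mul_log hT
  set Y := Real.sqrt (T * Real.log T) with hY
  have hY0 : 0 ≤ Y := Real.sqrt_nonneg _
  have hYsq : Y ^ 2 = T * Real.log T := Real.sq_sqrt (by positivity)
  have hK : Real.sqrt (2 * T * (2 * Real.log T)) = 2 * Y := by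
    rw [show 2 * (T : ℝ) * (2 * Real.log T) = (2 * Y) ^ 2 by rw [mul_pow, hYsq]; ring]
    exact Real.sqrt_sq (by positivity)
  have hsT : Real.sqrt T ≤ 2 * Y := by
    rw [Real.sqrt_le_left (by positivity), mul_pow, hYsq]
    nlinarith
  have hL : Real.log 2 + 2 * Real.log T ≤ 3 * Y := by
    have : Real.log T ≤ Y := Real.le_sqrt_of_sq_le (by nlinarith)
    linarith
  have hE : Real.sqrt (2 * T * (Real.log 2 + 2 * Real.log T)) ≤ 3 * Y := by
    rw [Real.sqrt_le_left (by positivity), mul_pow, hYsq]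
    nlinarith
  unfold pathRegretBound pathRegretConst
  rw [hK]
  -- The term without a square root is absorbed through `1 ≤ 2 * Y`; `c` names its replacement as an
  -- atom for `gcongr`.
  obtain ⟨c, hc⟩ : ∃ c, c = 2 * vmax * (2 * Y) := ⟨_, rfl⟩
  have hc' : 2 * vmax ≤ c := hc ▸ le_mul_of_one_le_right (by positivity) h1
  calc _ ≤ vmax * (2 * Y) + vmax * (1 + priceBound vmax ρ) * (2 * Y) +
      vmax / ρ * (c + vmax * (2 * Y)) +
      ((priceBound vmax ρ + vmax / ρ) ^ 2 * (vmax * (2 * Y) / 2) +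
        4 * vmax * (2 * (2 * Y) + 3 / 2 * (3 * Y))) +
      (3 * (vmax / ρ) + 2) * vmax * (3 * Y) := by
        gcongr
    _ = _ := by
        rw [hc]
        ring

/-! ### The benchmark -/

theorem feasible_zero {vmax ρ : ℝ} {F G : Measure ℝ} (hρ : 0 ≤ ρ) : Feasible vmax ρ F G fun _ => 0 :=
  ⟨measurable_const, fun _ _ => ⟨le_rfl, zero_le_one⟩, by simpa using hρ⟩

/-- Attainment of the supremum is not needed: a rule within `1 / T` of it loses at most `1` over `T`
rounds. -/
theorem exists_feasible_OPT_le {vmax ρ : ℝ} {F G : Measure ℝ} (hρ : 0 ≤ ρ) {T : ℕ} (hT : 1 ≤ T) :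
    ∃ π, Feasible vmax ρ F G π ∧
      OPT vmax ρ T F G ≤ (∫ z, π z.1 * reward z.1 z.2 ∂(F.prod G)) * T + 1 := by
  have hT' : (0 : ℝ) < T := by exact_mod_cast hT
  obtain ⟨_, ⟨π, hπ, rfl⟩, hlt⟩ := exists_lt_of_lt_csSup
    (s := {R : ℝ | ∃ π : ℝ → ℝ, Feasible vmax ρ F G π ∧
      R = ∫ z, π z.1 * reward z.1 z.2 ∂(F.prod G)}) ⟨_, _, feasible_zero hρ, rfl⟩
    (sub_lt_self _ (one_div_pos.2 hT'))
  refine ⟨π, hπ, ?_⟩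
  have h1 := mul_le_mul_of_nonneg_left hlt.le hT'.le
  rw [mul_sub, mul_one_div_cancel hT'.ne'] at h1
  unfold OPT
  linarith

section Bench
variable {vmax ρ : ℝ} {F G : Measure ℝ} [IsProbabilityMeasure F] [IsProbabilityMeasure G]

theorem Feasible.value_mem (hF : ∀ᵐ x ∂F, x ∈ Set.Icc 0 vmax) (hG : ∀ᵐ x ∂G, x ∈ Set.Icc 0 vmax)
    {π : ℝ → ℝ} (hπ : Feasible vmax ρ F G π) :
    ∫ z, π z.1 * reward z.1 z.2 ∂(F.prod G) ∈
      Set.Icc 0 (∫ z, reward z.1 z.2 ∂(F.prod G)) := by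
  have hr := boundedByValue_reward vmax
  have hone := hr.integrable_mul hF hG (g := fun _ => 1) measurable_const
    (fun _ _ => ⟨zero_le_one, le_rfl⟩)
  simp only [one_mul] at hone
  refine ⟨integral_nonneg_of_ae ?_, integral_mono_ae
    (hr.integrable_mul hF hG hπ.measurable hπ.mem_unit) hone ?_⟩
  all_goals
    filter_upwards [ae_prod_mem hF hG] with z hz
    have h1 := hr.mem_Icc _ hz.1 _ hz.2
    have h2 := hπ.mem_unit _ hz.1
  · exact mul_nonneg h2.1 h1.1
  · exact mul_le_of_le_one_left h1.1 h2.2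

theorem integral_reward_le (hF : ∀ᵐ x ∂F, x ∈ Set.Icc 0 vmax)
    (hG : ∀ᵐ x ∂G, x ∈ Set.Icc 0 vmax) : ∫ z, reward z.1 z.2 ∂(F.prod G) ≤ vmax := by
  have hr := boundedByValue_reward vmax
  have hone := hr.integrable_mul hF hG (g := fun _ => 1) measurable_const
    (fun _ _ => ⟨zero_le_one, le_rfl⟩)
  simp only [one_mul] at hone
  calc _ ≤ ∫ _, vmax ∂(F.prod G) := by
        refine integral_mono_ae hone (integrable_const _) ?_
        filter_upwards [ae_prod_mem hF hG] with z hz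
        exact (hr.mem_Icc _ hz.1 _ hz.2).2.trans hz.1.2
    _ = vmax := by simp

theorem OPT_le (hρ : 0 ≤ ρ) (hF : ∀ᵐ x ∂F, x ∈ Set.Icc 0 vmax)
    (hG : ∀ᵐ x ∂G, x ∈ Set.Icc 0 vmax) (T : ℕ) :
    OPT vmax ρ T F G ≤ T * ∫ z, reward z.1 z.2 ∂(F.prod G) := by
  refine mul_le_mul_of_nonneg_left (csSup_le ⟨_, _, feasible_zero hρ, rfl⟩ ?_) (Nat.cast_nonneg T)
  rintro _ ⟨π, hπ, rfl⟩
  exact (hπ.value_mem hF hG).2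

end Bench

/-! ### Reduction to paths lying in the box everywhere -/

section Path
variable {vmax ρ : ℝ} {T : ℕ}

theorem measurable_revenue :
    Measurable fun h : ℕ → ℝ × ℝ => revenue vmax ρ T (fun t => (h t).1) (fun t => (h t).2) := by
  simp only [revenue_eq_sum_choice]
  exact Finset.measurable_sum _ fun i _ => ((measurable_choice i).comp
    (measurable_next_value i)).mul (measurable_reward.comp (measurable_pi_apply (i + 1)))

theorem InBox.revenue_mem {h : ℕ → ℝ × ℝ} (hh : InBox vmax h) :
    revenue vmax ρ T (fun t => (h t).1) (fun t => (h t).2) ∈ Set.Icc 0 (T * vmax) := by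
  rw [revenue_eq_sum_choice]
  have hterm : ∀ i, choice vmax ρ T i h (h (i + 1)).1 * reward (h (i + 1)).1 (h (i + 1)).2 ∈
      Set.Icc 0 vmax := fun i => by
    have h1 := reward_mem_Icc (hh (i + 1)).1.1 (hh (i + 1)).2.1
    have h2 := (hh (i + 1)).1
    rcases choice_eq_zero_or_one (vmax := vmax) (ρ := ρ) (T := T) i h (h (i + 1)).1 with hx | hx
    · rw [hx, zero_mul]
      exact ⟨le_rfl, h2.1.trans h2.2⟩
    · rw [hx, one_mul]
      exact ⟨h1.1, h1.2.trans h2.2⟩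
  exact ⟨Finset.sum_nonneg fun i _ => (hterm i).1,
    (Finset.sum_le_sum fun i _ => (hterm i).2).trans (by simp)⟩

theorem revenue_congr {h h' : ℕ → ℝ × ℝ} (hh : ∀ s ∈ Finset.Icc 1 T, h s = h' s) :
    revenue vmax ρ T (fun t => (h t).1) (fun t => (h t).2) =
      revenue vmax ρ T (fun t => (h' t).1) (fun t => (h' t).2) := by
  rw [revenue_eq_sum_choice, revenue_eq_sum_choice]
  refine Finset.sum_congr rfl fun i hi => ?_
  have hi' := Finset.mem_range.1 hi
  have hhi : ∀ s ∈ Finset.Icc 1 i, h s = h' s := fun s hs => hh s (by simp at hs ⊢; omega)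
  rw [hh (i + 1) (by simp; omega), choice_congr_of_pathState_eq hhi (pathState_congr hhi)]

/-- The path of values and bids, clamped to `[0, vmax]` and set to `0` outside `1, …, T`. -/
noncomputable def clampedPath {Ω : Type*} (vmax : ℝ) (T : ℕ) (v p : ℕ → Ω → ℝ) (ω : Ω) (t : ℕ) : ℝ × ℝ :=
  if t ∈ Finset.Icc 1 T then (max 0 (min vmax (v t ω)), max 0 (min vmax (p t ω))) else 0

theorem inBox_clampedPath {Ω : Type*} (hv : 0 ≤ vmax) (v p : ℕ → Ω → ℝ) (ω : Ω) :
    InBox vmax (clampedPath vmax T v p ω) := by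
  intro t
  unfold clampedPath
  split_ifs
  · simp [hv]
  · simp [hv]

end Path

section Transfer
variable {Ω : Type*} [MeasurableSpace Ω] {μ : Measure Ω} {vmax : ℝ} {T : ℕ}

theorem IIDPath.integrable_revenue [IsProbabilityMeasure μ] {ρ : ℝ} {Z : Ω → ℕ → ℝ × ℝ}
    {ν : Measure (ℝ × ℝ)} (hZ : IIDPath μ ν T Z)
    (hbox : ∀ ω, InBox vmax (Z ω)) :
    Integrable (fun ω => revenue vmax ρ T (fun t => (Z ω t).1) (fun t => (Z ω t).2)) μ :=
  Integrable.of_mem_Icc 0 (T * vmax) (measurable_revenue.comp hZ.measurable).aemeasurable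
    (Filter.Eventually.of_forall fun ω => (hbox ω).revenue_mem)

theorem clampedPath_ae_eq {F G : Measure ℝ} {v p : ℕ → Ω → ℝ} (hF : ∀ᵐ x ∂F, x ∈ Set.Icc 0 vmax)
    (hG : ∀ᵐ x ∂G, x ∈ Set.Icc 0 vmax)
    (hvm : ∀ t ∈ Finset.Icc 1 T, Measurable (v t) ∧ μ.map (v t) = F)
    (hpm : ∀ t ∈ Finset.Icc 1 T, Measurable (p t) ∧ μ.map (p t) = G) :
    ∀ᵐ ω ∂μ, ∀ t ∈ Finset.Icc 1 T, clampedPath vmax T v p ω t = (v t ω, p t ω) := by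
  rw [Filter.eventually_all_finset]
  intro t ht
  have h1 := ae_of_ae_map (hvm t ht).1.aemeasurable ((hvm t ht).2.symm ▸ hF)
  have h2 := ae_of_ae_map (hpm t ht).1.aemeasurable ((hpm t ht).2.symm ▸ hG)
  filter_upwards [h1, h2] with ω hω1 hω2
  rw [clampedPath, if_pos ht, min_eq_right hω1.2, min_eq_right hω2.2, max_eq_right hω1.1,
    max_eq_right hω2.1]

/-- The pairs of rounds up to `i` and the pair of round `i + 1` are measurable functions, `φ` and
`ψ`, of disjoint blocks of one independent family. Clamping changes nothing almost surely, so the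
laws are unaffected. -/
theorem iidPath_clampedPath [IsProbabilityMeasure μ] {F G : Measure ℝ} {v p : ℕ → Ω → ℝ}
    (hF : ∀ᵐ x ∂F, x ∈ Set.Icc 0 vmax)
    (hG : ∀ᵐ x ∂G, x ∈ Set.Icc 0 vmax)
    (hvm : ∀ t ∈ Finset.Icc 1 T, Measurable (v t) ∧ μ.map (v t) = F)
    (hpm : ∀ t ∈ Finset.Icc 1 T, Measurable (p t) ∧ μ.map (p t) = G)
    (hind : iIndepFun (Sum.elim (fun t : Finset.Icc 1 T => v t)
      (fun t : Finset.Icc 1 T => p t)) μ) :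
    IIDPath μ (F.prod G) T (clampedPath vmax T v p) where
  measurable := by
    refine measurable_pi_lambda _ fun t => ?_
    unfold clampedPath
    by_cases ht : t ∈ Finset.Icc 1 T
    · simp only [ht, if_true]
      have h1 := (hvm t ht).1
      have h2 := (hpm t ht).1
      fun_prop
    · simp only [ht, if_false, measurable_const]
  law := by
    intro i hi
    have hmem : i + 1 ∈ Finset.Icc 1 T := by simp; omega
    have h1 : (fun ω => clampedPath vmax T v p ω (i + 1)) =ᵐ[μ]
        fun ω => (v (i + 1) ω, p (i + 1) ω) :=
      (clampedPath_ae_eq hF hG hvm hpm).mono fun ω hω => hω _ hmem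
    have h2 : IndepFun (v (i + 1)) (p (i + 1)) μ :=
      hind.indepFun (i := Sum.inl ⟨i + 1, hmem⟩) (j := Sum.inr ⟨i + 1, hmem⟩) (by simp)
    rw [Measure.map_congr h1, h2.map_prod_eq_prod_map_map (hvm _ hmem).1.aemeasurable
      (hpm _ hmem).1.aemeasurable, (hvm _ hmem).2, (hpm _ hmem).2]
  indep := by
    intro i hi
    have hmem : i + 1 ∈ Finset.Icc 1 T := by simp; omega
    let idx : Finset.Icc 1 T ⊕ Finset.Icc 1 T → ℕ := Sum.elim (fun t => t) (fun t => t)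
    let S : Finset (Finset.Icc 1 T ⊕ Finset.Icc 1 T) := Finset.univ.filter fun j => idx j ≤ i
    let S' : Finset (Finset.Icc 1 T ⊕ Finset.Icc 1 T) := Finset.univ.filter fun j => idx j = i + 1
    have hdisj : Disjoint S S' := by
      rw [Finset.disjoint_left]
      intro j hj hj'
      simp only [S, S', Finset.mem_filter, Finset.mem_univ, true_and] at hj hj'
      omega
    have hmeas : ∀ j, Measurable (Sum.elim (fun t : Finset.Icc 1 T => v t)
        (fun t : Finset.Icc 1 T => p t) j) := by
      rintro (t | t)
      · exact (hvm t t.2).1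
      · exact (hpm t t.2).1
    let φ : (S → ℝ) → ℕ → ℝ × ℝ := fun a s =>
      if h : s ≤ i ∧ s ∈ Finset.Icc 1 T then
        (max 0 (min vmax (a ⟨Sum.inl ⟨s, h.2⟩, by simpa [S, idx] using h.1⟩)),
          max 0 (min vmax (a ⟨Sum.inr ⟨s, h.2⟩, by simpa [S, idx] using h.1⟩))) else 0
    let ψ : (S' → ℝ) → ℝ × ℝ := fun a =>
      (max 0 (min vmax (a ⟨Sum.inl ⟨i + 1, hmem⟩, by simp [S', idx]⟩)),
        max 0 (min vmax (a ⟨Sum.inr ⟨i + 1, hmem⟩, by simp [S', idx]⟩)))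
    have hφ : Measurable φ := by
      refine measurable_pi_lambda _ fun s => ?_
      by_cases h : s ≤ i ∧ s ∈ Finset.Icc 1 T
      · simp only [φ, h, and_self, dite_true]
        fun_prop
      · simp only [φ, h, dite_false, measurable_const]
    have hψ : Measurable ψ := by
      simp only [ψ]
      fun_prop
    have h1 := (hind.indepFun_finset S S' hdisj hmeas).comp hφ hψ
    convert h1 using 1
    · funext ω s
      by_cases h : s ≤ i <;> by_cases h' : s ∈ Finset.Icc 1 T <;>
        simp [φ, trunc, clampedPath, h, h', -Finset.mem_Icc]
    · funext ω
      simp only [clampedPath, if_pos hmem]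
      rfl

end Transfer

/-! ### High-probability and expectation bounds -/

section Main
variable {Ω : Type*} [MeasurableSpace Ω] {μ : Measure Ω} [IsProbabilityMeasure μ]
  {vmax ρ : ℝ} {F G : Measure ℝ} [IsProbabilityMeasure F] [IsProbabilityMeasure G]
  {T : ℕ} {Z : Ω → ℕ → ℝ × ℝ}

theorem IIDPath.measureReal_pathRegret_gt_le (hZ : IIDPath μ (F.prod G) T Z)
    (hbox : ∀ ω, InBox vmax (Z ω)) (hρ : 0 < ρ) (hρv : ρ ≤ vmax)
    (hF : ∀ᵐ x ∂F, x ∈ Set.Icc 0 vmax) (hG : ∀ᵐ x ∂G, x ∈ Set.Icc 0 vmax) (hT : 1 ≤ T)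
    {π : ℝ → ℝ} (hπ : Feasible vmax ρ F G π) :
    μ.real {ω | pathRegretBound vmax ρ T < (∫ z, π z.1 * reward z.1 z.2 ∂(F.prod G)) * T -
      revenue vmax ρ T (fun t => (Z ω t).1) (fun t => (Z ω t).2)} ≤ 4 / T := by
  have hv : 0 < vmax := hρ.trans_le hρv
  have hr := boundedByValue_reward vmax
  have hc := boundedByValue_cost vmax
  have hL : 0 ≤ 2 * Real.log T := mul_nonneg zero_le_two (Real.log_natCast_nonneg T)
  have hq : (0 : ℝ) ≤ 1 / (T : ℝ) ^ 2 := by positivity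
  let badEst : (ℝ → ℝ → ℝ) → ℕ → Set Ω := fun f n => {ω | radius T n * (Z ω (n + 1)).1 <
    |(∑ i ∈ Finset.Icc 1 n, f (Z ω (n + 1)).1 (Z ω i).2) / n - bidMean G f (Z ω (n + 1)).1|}
  have hEst : ∀ f, BoundedByValue vmax f →
      μ.real (⋃ n ∈ Finset.Ico 1 T, badEst f n) ≤ (T - 1) * (1 / (T : ℝ) ^ 2) := by
    intro f hf
    refine (measureReal_biUnion_finset_le _ _).trans ((Finset.sum_le_sum fun n hn =>
      ENNReal.toReal_le_of_le_ofReal hq (hZ.measure_estimate_next_le hbox hf hF hG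
        (by simp at hn; omega) (Finset.mem_Ico.1 hn).2)).trans (le_of_eq ?_))
    rw [Finset.sum_const, Nat.card_Ico, nsmul_eq_mul, Nat.cast_sub hT, Nat.cast_one]
  -- The signs differ: realized revenue must not fall below its conditional means, while realized
  -- cost must not exceed them, so that a spent budget forces large conditional costs.
  have h1 := hZ.measure_sum_choice_gt_le (ρ := ρ) hv hr hF hG (Or.inr rfl) hL
  have h2 := hZ.measure_sum_choice_gt_le (ρ := ρ) hv hc hF hG (Or.inl rfl) hL
  have h3 := hZ.measure_sum_lagrangeGap_gt_le hbox hρ hρv hF hG hπ hL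
  rw [exp_neg_two_mul_log hT] at h1 h2 h3
  have h1' := ENNReal.toReal_le_of_le_ofReal hq h1
  have h2' := ENNReal.toReal_le_of_le_ofReal hq h2
  have h3' := ENNReal.toReal_le_of_le_ofReal hq h3
  have hval := hπ.value_mem hF hG
  have hsub : {ω | pathRegretBound vmax ρ T < (∫ z, π z.1 * reward z.1 z.2 ∂(F.prod G)) * T -
      revenue vmax ρ T (fun t => (Z ω t).1) (fun t => (Z ω t).2)} ⊆
      (⋃ n ∈ Finset.Ico 1 T, badEst reward n) ∪ ((⋃ n ∈ Finset.Ico 1 T, badEst cost n) ∪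
      ({ω | vmax * Real.sqrt (2 * T * (2 * Real.log T)) < ∑ n ∈ Finset.range T,
        choice vmax ρ T n (Z ω) (Z ω (n + 1)).1 * (-1 *
          (reward (Z ω (n + 1)).1 (Z ω (n + 1)).2 - bidMean G reward (Z ω (n + 1)).1))} ∪
      ({ω | vmax * Real.sqrt (2 * T * (2 * Real.log T)) < ∑ n ∈ Finset.range T,
        choice vmax ρ T n (Z ω) (Z ω (n + 1)).1 * (1 *
          (cost (Z ω (n + 1)).1 (Z ω (n + 1)).2 - bidMean G cost (Z ω (n + 1)).1))} ∪
      {ω | vmax * (1 + priceBound vmax ρ) * Real.sqrt (2 * T * (2 * Real.log T)) <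
        ∑ n ∈ Finset.range T, lagrangeGap vmax ρ T π (bidMean G reward) (bidMean G cost)
          (∫ z, π z.1 * reward z.1 z.2 ∂(F.prod G)) n (Z ω) (Z ω (n + 1)).1}))) := by
    intro ω hω
    by_contra hnot
    simp only [badEst, Set.mem_union, Set.mem_iUnion, Set.mem_ofPred_eq, not_or, not_exists, not_lt]
      at hnot
    obtain ⟨g1, g2, g3, g4, g5⟩ := hnot
    rw [Set.mem_ofPred_eq] at hω
    refine absurd hω (not_lt.2 ?_)
    refine (hbox ω).regret_le hρ hρv hT ⟨hval.1, hval.2.trans (integral_reward_le hF hG)⟩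
      (by positivity) hπ.mem_unit (fun w hw => (hr.bidMean_mem hG hw).1)
      (fun w hw => (hc.bidMean_mem hG hw).2) g1 g2 ?_ ?_ g5
    · simpa only [neg_one_mul, neg_sub] using g3
    · simpa only [one_mul] using g4
  have hT' : (1 : ℝ) ≤ T := by exact_mod_cast hT
  refine (measureReal_mono hsub).trans ?_
  refine (measureReal_union_le _ _).trans ((add_le_add (hEst _ hr)
    ((measureReal_union_le _ _).trans (add_le_add (hEst _ hc)
    ((measureReal_union_le _ _).trans (add_le_add h1'
    ((measureReal_union_le _ _).trans (add_le_add h2' h3'))))))).trans ?_)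
  -- Two families of `T - 1` estimate events and three sums, each failing with probability at most
  -- `1 / T ^ 2`, total `(2 * T + 1) / T ^ 2`.
  rw [← sub_nonneg]
  have : 4 / (T : ℝ) - ((T - 1) * (1 / (T : ℝ) ^ 2) + ((T - 1) * (1 / (T : ℝ) ^ 2) +
      (1 / (T : ℝ) ^ 2 + (1 / (T : ℝ) ^ 2 + 1 / (T : ℝ) ^ 2)))) = (2 * T - 1) / (T : ℝ) ^ 2 := by
    field_simp
    ring
  rw [this]
  exact div_nonneg (by linarith) (by positivity)

/-- At `T = 1` the target bound is `0`, as `log 1 = 0`. The single round is always entered, so its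
mean revenue is that of the unconstrained rule `π = 1`, which the benchmark cannot exceed. -/
theorem IIDPath.integral_regret_one_le (hZ : IIDPath μ (F.prod G) 1 Z)
    (hbox : ∀ ω, InBox vmax (Z ω)) (hρ : 0 ≤ ρ)
    (hF : ∀ᵐ x ∂F, x ∈ Set.Icc 0 vmax) (hG : ∀ᵐ x ∂G, x ∈ Set.Icc 0 vmax) :
    ∫ ω, regret vmax ρ 1 F G (fun t => (Z ω t).1) (fun t => (Z ω t).2) ∂μ ≤ 0 := by
  unfold regret
  rw [integral_sub (integrable_const _) (hZ.integrable_revenue hbox)]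
  have h1 : ∀ ω, revenue vmax ρ 1 (fun t => (Z ω t).1) (fun t => (Z ω t).2) =
      reward (Z ω 1).1 (Z ω 1).2 := fun ω => by
    rw [revenue_eq_sum_choice, Finset.sum_range_one, choice, if_pos rfl, alive_zero, one_mul]
  have h2 : ∫ ω, reward (Z ω 1).1 (Z ω 1).2 ∂μ = ∫ z, reward z.1 z.2 ∂(F.prod G) := by
    have hm : Measurable fun ω => Z ω (0 + 1) := (measurable_pi_apply _).comp hZ.measurable
    rw [← hZ.law 0 one_pos, integral_map hm.aemeasurable measurable_reward.aestronglyMeasurable]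
  have h3 := OPT_le hρ hF hG 1
  simp only [h1, h2, integral_const, probReal_univ, smul_eq_mul, one_mul]
  simpa using h3

/-- Regret bound for OGD-CB on a path that takes its values in the box everywhere. -/
theorem IIDPath.regret_bounds (hZ : IIDPath μ (F.prod G) T Z)
    (hbox : ∀ ω, InBox vmax (Z ω)) (hρ : 0 < ρ) (hρv : ρ ≤ vmax)
    (hF : ∀ᵐ x ∂F, x ∈ Set.Icc 0 vmax) (hG : ∀ᵐ x ∂G, x ∈ Set.Icc 0 vmax) (hT : 1 ≤ T) :
    1 - 4 / (T : ℝ) ≤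
        μ.real {ω | regret vmax ρ T F G (fun t => (Z ω t).1) (fun t => (Z ω t).2) ≤
          (pathRegretConst vmax ρ + 2 + 8 * vmax) * Real.sqrt (T * Real.log T)} ∧
      Integrable (fun ω => regret vmax ρ T F G (fun t => (Z ω t).1) (fun t => (Z ω t).2)) μ ∧
      ∫ ω, regret vmax ρ T F G (fun t => (Z ω t).1) (fun t => (Z ω t).2) ∂μ ≤
        (pathRegretConst vmax ρ + 2 + 8 * vmax) * Real.sqrt (T * Real.log T) := by
  have hv : 0 < vmax := hρ.trans_le hρv
  have hint : Integrable (fun ω => regret vmax ρ T F G (fun t => (Z ω t).1)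
      (fun t => (Z ω t).2)) μ := (integrable_const _).sub (hZ.integrable_revenue hbox)
  rcases hT.eq_or_lt with rfl | hT2
  · refine ⟨le_trans (by norm_num) measureReal_nonneg, hint, ?_⟩
    simpa using hZ.integral_regret_one_le hbox hρ.le hF hG
  have hT' : (0 : ℝ) < T := by exact_mod_cast hT
  have hY1 := one_le_two_mul_sqrt_mul_log (T := T) (by omega)
  obtain ⟨π, hπ, hopt⟩ := exists_feasible_OPT_le (vmax := vmax) (F := F) (G := G) hρ.le hT
  have hbound := pathRegretBound_le hρ hρv (T := T) (by omega)
  have hprob := hZ.measureReal_pathRegret_gt_le hbox hρ hρv hF hG hT hπ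
  set Y := Real.sqrt (T * Real.log T)
  set reg : Ω → ℝ := fun ω => regret vmax ρ T F G (fun t => (Z ω t).1) (fun t => (Z ω t).2)
    with hreg
  have hregm : Measurable reg := (measurable_revenue.comp hZ.measurable).const_sub _
  set b := (pathRegretConst vmax ρ + 2) * Y with hb
  have hbad : μ.real {ω | b < reg ω} ≤ 4 / T := by
    refine (measureReal_mono fun ω (hω : b < reg ω) => ?_).trans hprob
    have : reg ω = OPT vmax ρ T F G -
      revenue vmax ρ T (fun t => (Z ω t).1) (fun t => (Z ω t).2) := rfl
    rw [Set.mem_ofPred_eq]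
    linarith
  have hcb : b ≤ (pathRegretConst vmax ρ + 2 + 8 * vmax) * Y := by
    have := mul_nonneg hv.le (Real.sqrt_nonneg (T * Real.log T))
    linarith
  refine ⟨?_, hint, ?_⟩
  · have huniv : (1 : ℝ) ≤ μ.real ({ω | b < reg ω} ∪
        {ω | reg ω ≤ (pathRegretConst vmax ρ + 2 + 8 * vmax) * Y}) := by
      rw [show {ω | b < reg ω} ∪ {ω | reg ω ≤ (pathRegretConst vmax ρ + 2 + 8 * vmax) * Y} =
        Set.univ from Set.eq_univ_of_forall fun ω => (lt_or_ge b (reg ω)).imp id fun h =>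
          h.trans hcb]
      exact probReal_univ.ge
    have := huniv.trans (measureReal_union_le _ _)
    linarith
  · have hms : MeasurableSet {ω | b < reg ω} := measurableSet_lt measurable_const hregm
    -- On the bad event the trivial bound `T * vmax` is used; its probability `4 / T` turns this
    -- into the constant `4 * vmax`, at most `8 * vmax * Y`.
    have hle : ∀ ω, reg ω ≤ b + Set.indicator {ω | b < reg ω} (fun _ => T * vmax) ω := by
      intro ω
      by_cases hω : b < reg ω
      · rw [Set.indicator_of_mem (show ω ∈ {ω | b < reg ω} from hω)]
        have h1 : reg ω ≤ OPT vmax ρ T F G := sub_le_self _ (hbox ω).revenue_mem.1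
        have h2 := (OPT_le hρ.le hF hG T).trans
          (mul_le_mul_of_nonneg_left (integral_reward_le hF hG) hT'.le)
        have h3 : 0 ≤ b := by
          have h4 : 0 ≤ pathRegretConst vmax ρ := by
            unfold pathRegretConst priceBound
            positivity
          positivity
        linarith
      · rw [Set.indicator_of_notMem (show ω ∉ {ω | b < reg ω} from hω), add_zero]
        exact not_lt.1 hω
    calc ∫ ω, reg ω ∂μ
        ≤ ∫ ω, b + Set.indicator {ω | b < reg ω} (fun _ => T * vmax) ω ∂μ :=
          integral_mono hint ((integrable_const b).add
            ((integrable_const (T * vmax)).indicator hms)) hle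
      _ = b + μ.real {ω | b < reg ω} * (T * vmax) := by
          rw [integral_add (integrable_const b) ((integrable_const (T * vmax)).indicator hms),
            integral_indicator_const _ hms]
          simp
      _ ≤ b + 4 / T * (T * vmax) := by gcongr
      _ = b + 4 * vmax := by field_simp
      _ ≤ _ := by
          have := mul_le_mul_of_nonneg_left hY1 (show 0 ≤ 4 * vmax by positivity)
          linarith

end Main
end Throttling

theorem mainTheorem4 (vmax ρ : ℝ) (hρ : 0 < ρ) (hρv : ρ ≤ vmax) :
    ∃ C : ℝ, 0 < C ∧
      ∀ (F G : MeasureTheory.Measure ℝ)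
        [MeasureTheory.IsProbabilityMeasure F] [MeasureTheory.IsProbabilityMeasure G],
        (∀ᵐ x ∂F, x ∈ Set.Icc 0 vmax) → (∀ᵐ x ∂G, x ∈ Set.Icc 0 vmax) →
      ∀ (T : ℕ), 1 ≤ T →
      ∀ (Ω : Type*) [MeasurableSpace Ω] (μ : MeasureTheory.Measure Ω)
        [MeasureTheory.IsProbabilityMeasure μ] (v p : ℕ → Ω → ℝ),
        (∀ t ∈ Finset.Icc 1 T, Measurable (v t) ∧ μ.map (v t) = F) →
        (∀ t ∈ Finset.Icc 1 T, Measurable (p t) ∧ μ.map (p t) = G) →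
        ProbabilityTheory.iIndepFun
          (Sum.elim (fun t : Finset.Icc 1 T => v t) (fun t : Finset.Icc 1 T => p t)) μ →
        1 - 4 / (T : ℝ) ≤
            μ.real {ω | Throttling.regret vmax ρ T F G (fun t => v t ω) (fun t => p t ω) ≤
              C * Real.sqrt (T * Real.log T)} ∧
          MeasureTheory.Integrable
            (fun ω => Throttling.regret vmax ρ T F G (fun t => v t ω) (fun t => p t ω)) μ ∧
          ∫ ω, Throttling.regret vmax ρ T F G (fun t => v t ω) (fun t => p t ω) ∂μ ≤
            C * Real.sqrt (T * Real.log T) := by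
  refine ⟨Throttling.pathRegretConst vmax ρ + 2 + 8 * vmax, ?_, ?_⟩
  · have hv : 0 < vmax := hρ.trans_le hρv
    unfold Throttling.pathRegretConst Throttling.priceBound
    positivity
  intro F G _ _ hF hG T hT Ω _ μ _ v p hvm hpm hind
  have hv : 0 < vmax := hρ.trans_le hρv
  -- The data lie in the box only almost surely; the clamped path lies there surely and almost
  -- surely agrees on the rounds `1, …, T`, which determine the regret.
  have hZ := Throttling.iidPath_clampedPath hF hG hvm hpm hind
  obtain ⟨h1, h2, h3⟩ := hZ.regret_bounds (Throttling.inBox_clampedPath hv.le v p) hρ hρv hF hG hT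
  have hae : (fun ω => Throttling.regret vmax ρ T F G
      (fun t => (Throttling.clampedPath vmax T v p ω t).1)
      (fun t => (Throttling.clampedPath vmax T v p ω t).2)) =ᵐ[μ]
      fun ω => Throttling.regret vmax ρ T F G (fun t => v t ω) (fun t => p t ω) := by
    filter_upwards [Throttling.clampedPath_ae_eq hF hG hvm hpm] with ω hω
    unfold Throttling.regret
    rw [Throttling.revenue_congr (h' := fun t => (v t ω, p t ω)) hω]
  refine ⟨h1.trans_eq (MeasureTheory.measureReal_congr ?_), h2.congr hae,
    (MeasureTheory.integral_congr_ae hae).symm.trans_le h3⟩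
  filter_upwards [hae] with ω hω
  exact congrArg (· ≤ _) hω
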